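/- Let $0<l_0<l$, let $E,I,\rho,m,\varkappa,\alpha_0$ be positive constants, let $\alpha_1,\dots,\alpha_k>0$, and let $\psi_1,\dots,\psi_k$ be real functions on $[0,l]$ with $\psi_j''\in C^2[0,l]$ and $\operatorname{supp}\psi_j\cap\{0,l_0,l\}=\emptyset$. Let the scalar field $\mathbb K$ be $\mathbb R$ or $\mathbb C$. Put $\mathring H^2(0,l)=\{u\in H^2(0,l): u(0)=u(l)=0\}$ and let $X=\mathring H^2(0,l)\times L^2(0,l)\times\mathbb K^2$, with elements $\xi=(u,v,p,q)$, carry the inner product $$\langle\xi_1,\xi_2\rangle_X=\int_0^l\bigl(EI\,u_1''\overline{u_2''}+\rho\, v_1\overline{v_2}\bigr)dx+\varkappa p_1\overline{p_2}+m q_1\overline{q_2}.$$ Let $D(\tilde A)$ be the set of all $(u,v,p,q)\in X$ such that $u\in H^4(0,l_0)\cap H^4(l_0,l)$, $u''(0)=u''(l)=0$, $u''(l_0-0)=u''(l_0+0)$, $v\in\mathring H^2(0,l)$, $p=u(l_0)$, $q=v(l_0)$, and let the closed-loop generator $\tilde A:D(\tilde A)\to X$ be $$\tilde A(u,v,p,q)=\Bigl(v,\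 -\tfrac{EI}{\rho}u''''+\tfrac1\rho\sum_{j=1}^k\psi_j''M_j,\ q,\ \tfrac1m(L-\varkappa p+F)\Bigr),$$ where $u''''$ is taken on $(0,l_0)$ and on $(l_0,l)$ separately, $L=EI\,(u'''(l_0-0)-u'''(l_0+0))$, $M_j=-\alpha_j\int_0^l\psi_j''v\,dx$ and $F=-\alpha_0q$. Let $X_0=\{(u,v,p,q)\in X: p=u(l_0)\}$. Theorem 1. For every $\lambda>0$ the operator $I-\lambda\tilde A$ is injective, its range is exactly $X_0$ (maximality of $\tilde A$), and the resolvent $R_\lambda(\tilde A)=(I-\lambda\tilde A)^{-1}$, an operator in $X$ defined on $X_0$, is compact. Moreover the trajectories of $\dot\xi=\tilde A\xi$ are precompact: if $\xi:[0,\infty)\to X$ is a mild solution, i.e. $\xi$ is continuous and for all $t\ge0$ one has $\int_0^t\xi(s)\,ds\in D(\tilde A)$ and $\xi(t)=\xi(0)+\tilde A\int_0^t\xi(s)\,ds$, then $\{\xi(t):t\ge0\}$ has compact closure in $X$. -/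

import Mathlib

open MeasureTheory Set Filter Topology

namespace ShakerBeam

noncomputable section

/-! ### Weak derivatives and Sobolev functions on a bounded interval -/

/-- `g` is the weak derivative of `u` on the open interval `(a, b)`. -/
def HasWeakDeriv {𝕜 : Type*} [RCLike 𝕜] (a b : ℝ) (u g : ℝ → 𝕜) : Prop :=
  ∀ φ : ℝ → ℝ, ContDiff ℝ (⊤ : ℕ∞) φ → HasCompactSupport φ → tsupport φ ⊆ Ioo a b →
    ∫ x in Ioo a b, deriv φ x • u x = -∫ x in Ioo a b, φ x • g x

/-- `u` belongs to the Sobolev space `Hⁿ(a, b)`: `u` and its weak derivatives up to order `n`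
are square integrable on `(a, b)`. -/
def MemSobolev {𝕜 : Type*} [RCLike 𝕜] (a b : ℝ) : ℕ → (ℝ → 𝕜) → Prop
  | 0, u => MemLp u 2 (volume.restrict (Ioo a b))
  | n + 1, u => MemLp u 2 (volume.restrict (Ioo a b)) ∧
      ∃ g : ℝ → 𝕜, HasWeakDeriv a b u g ∧ MemSobolev a b n g

open Classical in
/-- The square-integrable weak derivative of `u` on `(a, b)` (unique up to null sets; the junk
value `0` if there is none). -/
def weakDeriv {𝕜 : Type*} [RCLike 𝕜] (a b : ℝ) (u : ℝ → 𝕜) : ℝ → 𝕜 :=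
  if h : ∃ g : ℝ → 𝕜, HasWeakDeriv a b u g ∧ MemLp g 2 (volume.restrict (Ioo a b))
  then h.choose else 0

/-- `c` is the value at `x` of a representative of `u` that is continuous on `[a, b]`. -/
def HasPointValue {𝕜 : Type*} [RCLike 𝕜] (a b : ℝ) (u : ℝ → 𝕜) (x : ℝ) (c : 𝕜) : Prop :=
  ∃ f : ℝ → 𝕜, ContinuousOn f (Icc a b) ∧ u =ᵐ[volume.restrict (Ioo a b)] f ∧ f x = c

open Classical in
/-- The value at `x ∈ [a, b]` of the continuous representative of `u` on `[a, b]` (the junk value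
`0` if there is none). At an end point this is the one-sided limit of that representative. -/
def pointValue {𝕜 : Type*} [RCLike 𝕜] (a b : ℝ) (u : ℝ → 𝕜) (x : ℝ) : 𝕜 :=
  if h : ∃ c : 𝕜, HasPointValue a b u x c then h.choose else 0

section Basic

variable {𝕜 : Type*} [RCLike 𝕜] {a b : ℝ} {u v g h : ℝ → 𝕜}

theorem memLp_integrable (hu : MemLp u 2 (volume.restrict (Ioo a b))) :
    Integrable u (volume.restrict (Ioo a b)) :=
  hu.integrable one_le_two

theorem integrable_test_smul {φ : ℝ → ℝ} (hφ : Continuous φ) (hc : HasCompactSupport φ)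
    (hu : Integrable u (volume.restrict (Ioo a b))) :
    Integrable (fun x => φ x • u x) (volume.restrict (Ioo a b)) := by
  obtain ⟨C, hC⟩ := hc.exists_bound_of_continuous hφ
  exact hu.bdd_smul C hφ.aestronglyMeasurable (Eventually.of_forall hC)

theorem HasWeakDeriv.congr (hw : HasWeakDeriv a b u g)
    (hu : u =ᵐ[volume.restrict (Ioo a b)] v) (hg : g =ᵐ[volume.restrict (Ioo a b)] h) :
    HasWeakDeriv a b v h := by
  intro φ h1 h2 h3
  have e1 : ∫ x in Ioo a b, deriv φ x • v x = ∫ x in Ioo a b, deriv φ x • u x :=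
    integral_congr_ae (by filter_upwards [hu] with x hx; rw [hx])
  have e2 : ∫ x in Ioo a b, φ x • h x = ∫ x in Ioo a b, φ x • g x :=
    integral_congr_ae (by filter_upwards [hg] with x hx; rw [hx])
  rw [e1, e2]
  exact hw φ h1 h2 h3

theorem HasWeakDeriv.add (hw : HasWeakDeriv a b u g) (hw' : HasWeakDeriv a b v h)
    (hu : Integrable u (volume.restrict (Ioo a b)))
    (hv : Integrable v (volume.restrict (Ioo a b)))
    (hg : Integrable g (volume.restrict (Ioo a b)))
    (hh : Integrable h (volume.restrict (Ioo a b))) :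
    HasWeakDeriv a b (u + v) (g + h) := by
  intro φ h1 h2 h3
  have hd : Continuous (deriv φ) := h1.continuous_deriv (by simp)
  simp only [Pi.add_apply, smul_add]
  rw [integral_add (integrable_test_smul hd h2.deriv hu) (integrable_test_smul hd h2.deriv hv),
    integral_add (integrable_test_smul h1.continuous h2 hg)
      (integrable_test_smul h1.continuous h2 hh), hw φ h1 h2 h3, hw' φ h1 h2 h3, neg_add]

theorem HasWeakDeriv.smul (c : 𝕜) (hw : HasWeakDeriv a b u g) :
    HasWeakDeriv a b (c • u) (c • g) := by
  intro φ h1 h2 h3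
  simp only [Pi.smul_apply]
  have e1 : ∀ x, deriv φ x • c • u x = c • (deriv φ x • u x) := fun x => smul_comm _ _ _
  have e2 : ∀ x, φ x • c • g x = c • (φ x • g x) := fun x => smul_comm _ _ _
  simp only [e1, e2, integral_smul]
  rw [hw φ h1 h2 h3, smul_neg]

theorem HasWeakDeriv.unique (hw : HasWeakDeriv a b u g) (hw' : HasWeakDeriv a b u h)
    (hg : Integrable g (volume.restrict (Ioo a b)))
    (hh : Integrable h (volume.restrict (Ioo a b))) :
    g =ᵐ[volume.restrict (Ioo a b)] h := by
  have hgh : LocallyIntegrableOn (g - h) (Ioo a b) volume :=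
    IntegrableOn.locallyIntegrableOn (hg.sub hh)
  have key := isOpen_Ioo.ae_eq_zero_of_integral_contDiff_smul_eq_zero (μ := volume) hgh
    (fun φ h1 h2 h3 => by
      have hs : ∀ x, x ∉ Ioo a b → φ x • (g - h) x = 0 := fun x hx => by
        rw [image_eq_zero_of_notMem_tsupport (fun hx' => hx (h3 hx')), zero_smul]
      rw [← setIntegral_eq_integral_of_forall_compl_eq_zero hs]
      simp only [Pi.sub_apply, smul_sub]
      rw [integral_sub (integrable_test_smul h1.continuous h2 hg)
        (integrable_test_smul h1.continuous h2 hh), sub_eq_zero]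
      exact neg_injective ((hw φ h1 h2 h3).symm.trans (hw' φ h1 h2 h3)))
  refine (ae_restrict_iff' measurableSet_Ioo).2 ?_
  filter_upwards [key] with x hx hx'
  exact sub_eq_zero.1 (hx hx')

theorem MemSobolev.memLp {n : ℕ} (hu : MemSobolev a b n u) :
    MemLp u 2 (volume.restrict (Ioo a b)) := by
  cases n with
  | zero => exact hu
  | succ n => exact hu.1

theorem MemSobolev.congr {n : ℕ} (hu : MemSobolev a b n u)
    (huv : u =ᵐ[volume.restrict (Ioo a b)] v) : MemSobolev a b n v := by
  cases n with
  | zero => exact MemLp.ae_eq huv hu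
  | succ n =>
    obtain ⟨h1, g, h2, h3⟩ := hu
    exact ⟨MemLp.ae_eq huv h1, g, h2.congr huv (ae_eq_refl _), h3⟩

theorem MemSobolev.add {n : ℕ} (hu : MemSobolev a b n u) (hv : MemSobolev a b n v) :
    MemSobolev a b n (u + v) := by
  induction n generalizing u v with
  | zero => exact MemLp.add hu hv
  | succ n ih =>
    obtain ⟨h1, g, h2, h3⟩ := hu
    obtain ⟨k1, h, k2, k3⟩ := hv
    exact ⟨h1.add k1, g + h, h2.add k2 (memLp_integrable h1) (memLp_integrable k1)
      (memLp_integrable h3.memLp) (memLp_integrable k3.memLp), ih h3 k3⟩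

theorem MemSobolev.smul {n : ℕ} (c : 𝕜) (hu : MemSobolev a b n u) :
    MemSobolev a b n (c • u) := by
  induction n generalizing u with
  | zero => exact MemLp.const_smul hu c
  | succ n ih =>
    obtain ⟨h1, g, h2, h3⟩ := hu
    exact ⟨h1.const_smul c, c • g, h2.smul c, ih h3⟩

theorem MemSobolev.zero {n : ℕ} : MemSobolev a b n (0 : ℝ → 𝕜) := by
  induction n with
  | zero => exact MemLp.zero'
  | succ n ih => exact ⟨MemLp.zero', 0, fun φ _ _ _ => by simp, ih⟩

theorem MemSobolev.weakDeriv_spec {n : ℕ} (hu : MemSobolev a b (n + 1) u) :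
    HasWeakDeriv a b u (weakDeriv a b u) ∧ MemSobolev a b n (weakDeriv a b u) := by
  obtain ⟨h1, g, h2, h3⟩ := hu
  have hex : ∃ g : ℝ → 𝕜, HasWeakDeriv a b u g ∧ MemLp g 2 (volume.restrict (Ioo a b)) :=
    ⟨g, h2, h3.memLp⟩
  have e : weakDeriv a b u = hex.choose := dif_pos hex
  rw [e]
  refine ⟨hex.choose_spec.1, h3.congr ?_⟩
  exact h2.unique hex.choose_spec.1 (memLp_integrable h3.memLp)
    (memLp_integrable hex.choose_spec.2)

open Classical in
theorem weakDeriv_congr (huv : u =ᵐ[volume.restrict (Ioo a b)] v) :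
    weakDeriv a b u = weakDeriv a b v := by
  have e : (fun g : ℝ → 𝕜 => HasWeakDeriv a b u g ∧ MemLp g 2 (volume.restrict (Ioo a b))) =
      fun g => HasWeakDeriv a b v g ∧ MemLp g 2 (volume.restrict (Ioo a b)) := by
    funext g
    exact propext ⟨fun hg => ⟨hg.1.congr huv (ae_eq_refl _), hg.2⟩,
      fun hg => ⟨hg.1.congr huv.symm (ae_eq_refl _), hg.2⟩⟩
  have key : ∀ P Q : (ℝ → 𝕜) → Prop, P = Q →
      (if h : ∃ g, P g then h.choose else 0) = if h : ∃ g, Q g then h.choose else 0 := by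
    rintro P _ rfl; rfl
  exact key _ _ e

theorem weakDeriv_add (hu : MemSobolev a b 1 u) (hv : MemSobolev a b 1 v) :
    weakDeriv a b (u + v) =ᵐ[volume.restrict (Ioo a b)] weakDeriv a b u + weakDeriv a b v := by
  have h1 := hu.weakDeriv_spec
  have h2 := hv.weakDeriv_spec
  have h3 := (hu.add hv).weakDeriv_spec
  exact h3.1.unique (h1.1.add h2.1 (memLp_integrable hu.memLp) (memLp_integrable hv.memLp)
    (memLp_integrable h1.2.memLp) (memLp_integrable h2.2.memLp)) (memLp_integrable h3.2.memLp)
    ((memLp_integrable h1.2.memLp).add (memLp_integrable h2.2.memLp))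

theorem weakDeriv_smul (c : 𝕜) (hu : MemSobolev a b 1 u) :
    weakDeriv a b (c • u) =ᵐ[volume.restrict (Ioo a b)] c • weakDeriv a b u := by
  have h1 := hu.weakDeriv_spec
  have h3 := (hu.smul c).weakDeriv_spec
  exact h3.1.unique (h1.1.smul c) (memLp_integrable h3.2.memLp)
    ((memLp_integrable h1.2.memLp).smul c)

theorem MemSobolev.of_succ {n : ℕ} (hu : MemSobolev a b (n + 1) u) : MemSobolev a b n u := by
  induction n generalizing u with
  | zero => exact hu.1
  | succ n ih =>
    obtain ⟨h1, g, h2, h3⟩ := hu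
    exact ⟨h1, g, h2, ih h3⟩

theorem MemSobolev.mono {n m : ℕ} (hnm : m ≤ n) (hu : MemSobolev a b n u) :
    MemSobolev a b m u := by
  induction hnm with
  | refl => exact hu
  | step _ ih => exact ih hu.of_succ

theorem MemSobolev.iterate {n i : ℕ} (hu : MemSobolev a b (n + i) u) :
    MemSobolev a b n ((weakDeriv a b)^[i] u) := by
  induction i generalizing u with
  | zero => exact hu
  | succ i ih => exact ih (MemSobolev.weakDeriv_spec (n := n + i) hu).2

theorem iterate_weakDeriv_congr {i : ℕ} (huv : u =ᵐ[volume.restrict (Ioo a b)] v) :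
    (weakDeriv a b)^[i] u =ᵐ[volume.restrict (Ioo a b)] (weakDeriv a b)^[i] v := by
  cases i with
  | zero => exact huv
  | succ i => simp only [Function.iterate_succ_apply, weakDeriv_congr huv]; rfl

theorem iterate_weakDeriv_add {i : ℕ} (hu : MemSobolev a b i u) (hv : MemSobolev a b i v) :
    (weakDeriv a b)^[i] (u + v) =ᵐ[volume.restrict (Ioo a b)]
      (weakDeriv a b)^[i] u + (weakDeriv a b)^[i] v := by
  induction i generalizing u v with
  | zero => rfl
  | succ i ih =>
    simp only [Function.iterate_succ_apply]
    exact (iterate_weakDeriv_congr (weakDeriv_add (hu.mono (by omega)) (hv.mono (by omega)))).trans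
      (ih hu.weakDeriv_spec.2 hv.weakDeriv_spec.2)

theorem iterate_weakDeriv_smul {i : ℕ} (c : 𝕜) (hu : MemSobolev a b i u) :
    (weakDeriv a b)^[i] (c • u) =ᵐ[volume.restrict (Ioo a b)] c • (weakDeriv a b)^[i] u := by
  induction i generalizing u with
  | zero => rfl
  | succ i ih =>
    simp only [Function.iterate_succ_apply]
    exact (iterate_weakDeriv_congr (weakDeriv_smul c (hu.mono (by omega)))).trans
      (ih hu.weakDeriv_spec.2)

/-- Integration by parts against a primitive. -/
theorem hasWeakDeriv_primitive (hg : Integrable g (volume.restrict (Ioo a b))) :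
    HasWeakDeriv a b (fun x => ∫ t in a..x, g t) g := by
  intro φ h1 h2 h3
  have hd : Continuous (deriv φ) := h1.continuous_deriv (by simp)
  have hφb : ∀ x, x ∉ Ioo a b → φ x = 0 := fun x hx =>
    image_eq_zero_of_notMem_tsupport (fun hx' => hx (h3 hx'))
  have hdi : Integrable (deriv φ) (volume.restrict (Ioo a b)) :=
    (hd.integrable_of_hasCompactSupport h2.deriv).restrict
  let F : ℝ → ℝ → 𝕜 := fun x t => {p : ℝ × ℝ | p.2 < p.1}.indicator
    (fun p => deriv φ p.1 • g p.2) (x, t)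
  have hF : Integrable (Function.uncurry F)
      ((volume.restrict (Ioo a b)).prod (volume.restrict (Ioo a b))) := by
    have := (hdi.smul_prod hg).indicator
      (s := {p : ℝ × ℝ | p.2 < p.1}) (measurableSet_lt measurable_snd measurable_fst)
    exact this
  have hsw := integral_integral_swap hF
  have e1 : ∫ x in Ioo a b, ∫ t in Ioo a b, F x t =
      ∫ x in Ioo a b, deriv φ x • ∫ t in a..x, g t := by
    refine setIntegral_congr_fun measurableSet_Ioo (fun x hx => ?_)
    have : F x = (Iio x).indicator (fun t => deriv φ x • g t) := by
      funext t; simp [F, Set.indicator]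
    rw [this, integral_indicator measurableSet_Iio, Measure.restrict_restrict measurableSet_Iio,
      show Iio x ∩ Ioo a b = Ioo a x by
        ext t; simp only [mem_inter_iff, mem_Iio, mem_Ioo]
        exact ⟨fun h => ⟨h.2.1, h.1⟩, fun h => ⟨h.2, h.1, h.2.trans hx.2⟩⟩,
      integral_smul, intervalIntegral.integral_of_le hx.1.le, integral_Ioc_eq_integral_Ioo]
  have e2 : ∫ t in Ioo a b, ∫ x in Ioo a b, F x t = ∫ t in Ioo a b, -(φ t • g t) := by
    refine setIntegral_congr_fun measurableSet_Ioo (fun t ht => ?_)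
    have : (fun x => F x t) = (Ioi t).indicator (fun x => deriv φ x • g t) := by
      funext x; simp [F, Set.indicator]
    rw [this, integral_indicator measurableSet_Ioi, Measure.restrict_restrict measurableSet_Ioi,
      show Ioi t ∩ Ioo a b = Ioo t b by
        ext x; simp only [mem_inter_iff, mem_Ioi, mem_Ioo]
        exact ⟨fun h => ⟨h.1, h.2.2⟩, fun h => ⟨h.1, ht.1.trans h.1, h.2⟩⟩,
      integral_smul_const, ← integral_Ioc_eq_integral_Ioo,
      ← intervalIntegral.integral_of_le ht.2.le,
      intervalIntegral.integral_deriv_eq_sub (fun x _ => (h1.differentiable (by simp)) x)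
        (hd.intervalIntegrable _ _), hφb b (by simp), zero_sub, neg_smul]
  rw [← e1, hsw, e2, integral_neg]

/-- A function with vanishing weak derivative is constant. -/
theorem ae_eq_const_of_hasWeakDeriv_zero (hab : a < b)
    (hu : Integrable u (volume.restrict (Ioo a b))) (hw : HasWeakDeriv a b u 0) :
    ∃ c : 𝕜, u =ᵐ[volume.restrict (Ioo a b)] fun _ => c := by
  -- a bump function of integral one
  let B : ContDiffBump ((a + b) / 2 : ℝ) :=
    ⟨(b - a) / 8, (b - a) / 4, by linarith, by linarith⟩
  let ω : ℝ → ℝ := B.normed volume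
  have hω1 : ContDiff ℝ (⊤ : ℕ∞) ω := B.contDiff_normed
  have hω2 : HasCompactSupport ω := B.hasCompactSupport_normed
  have hω3 : tsupport ω ⊆ Ioo a b := by
    rw [B.tsupport_normed_eq]
    intro x hx
    rw [Metric.mem_closedBall, Real.dist_eq, abs_le] at hx
    have h4 : B.rOut = (b - a) / 4 := rfl
    rw [h4] at hx
    constructor <;> linarith [hx.1, hx.2]
  have hω4 : ∫ x, ω x = 1 := B.integral_normed
  let c : 𝕜 := ∫ x in Ioo a b, ω x • u x
  refine ⟨c, ?_⟩
  have hloc : LocallyIntegrableOn (fun x => u x - c) (Ioo a b) volume :=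
    IntegrableOn.locallyIntegrableOn (hu.sub (integrable_const c))
  have key := isOpen_Ioo.ae_eq_zero_of_integral_contDiff_smul_eq_zero (μ := volume) hloc
    (fun ψ h1 h2 h3 => by
      have hs : ∀ x, x ∉ Ioo a b → ψ x • (u x - c) = 0 := fun x hx => by
        rw [image_eq_zero_of_notMem_tsupport (fun hx' => hx (h3 hx')), zero_smul]
      rw [← setIntegral_eq_integral_of_forall_compl_eq_zero hs]
      -- the primitive of `ψ - (∫ ψ) ω` is a test function
      let J : ℝ := ∫ x, ψ x
      let θ : ℝ → ℝ := fun x => ψ x - J * ω x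
      have hθ1 : ContDiff ℝ (⊤ : ℕ∞) θ := h1.sub (contDiff_const.mul hω1)
      have hθ0 : ∀ x, x ∉ Ioo a b → θ x = 0 := fun x hx => by
        simp only [θ]
        rw [image_eq_zero_of_notMem_tsupport (fun hx' => hx (h3 hx')),
          image_eq_zero_of_notMem_tsupport (fun hx' => hx (hω3 hx'))]
        simp
      have hψi : Integrable ψ := h1.continuous.integrable_of_hasCompactSupport h2
      have hωi : Integrable ω := hω1.continuous.integrable_of_hasCompactSupport hω2
      have hθi : Integrable θ := hψi.sub (hωi.const_mul J)
      have hθint : ∫ x, θ x = 0 := by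
        have : ∫ x, θ x = (∫ x, ψ x) - ∫ x, J * ω x := integral_sub hψi (hωi.const_mul J)
        rw [this, integral_const_mul, hω4]; simp [J]
      let Φ : ℝ → ℝ := fun x => ∫ t in a..x, θ t
      have hΦd : ∀ x, HasDerivAt Φ (θ x) x := fun x =>
        hθ1.continuous.integral_hasStrictDerivAt a x |>.hasDerivAt
      have hderiv : deriv Φ = θ := funext fun x => (hΦd x).deriv
      have hΦ1 : ContDiff ℝ (⊤ : ℕ∞) Φ := by
        have : ContDiff ℝ (((⊤ : ℕ∞) : WithTop ℕ∞)) Φ := by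
          rw [contDiff_infty_iff_deriv, hderiv]
          exact ⟨fun x => (hΦd x).differentiableAt, hθ1⟩
        exact this
      -- support of the primitive
      let K : Set ℝ := tsupport ψ ∪ tsupport ω
      have hK : IsCompact K := h2.isCompact.union hω2.isCompact
      have hKs : K ⊆ Ioo a b := union_subset h3 hω3
      have hKne : K.Nonempty := by
        by_contra hne
        rw [Set.not_nonempty_iff_eq_empty] at hne
        have h0 : ∀ x, ω x = 0 := fun x => image_eq_zero_of_notMem_tsupport (fun hx => by
          have : x ∈ K := Or.inr hx
          rw [hne] at this; exact this)
        simp [h0] at hω4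
      have hθK : ∀ x, x ∉ K → θ x = 0 := fun x hx => by
        simp only [θ]
        rw [image_eq_zero_of_notMem_tsupport (fun hx' => hx (Or.inl hx')),
          image_eq_zero_of_notMem_tsupport (fun hx' => hx (Or.inr hx'))]
        simp
      obtain ⟨s, hs1, hs2⟩ := hK.exists_isLeast hKne
      obtain ⟨r, hr1, hr2⟩ := hK.exists_isGreatest hKne
      have hΦ0 : ∀ x, x ∉ Icc s r → Φ x = 0 := by
        intro x hx
        rw [mem_Icc, not_and_or, not_le, not_le] at hx
        rcases hx with hx | hx
        · have : ∀ t ∈ uIcc a x, θ t = 0 := by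
            intro t ht
            apply hθK
            intro htK
            have h5 := hs2 htK
            have h6 := (hKs hs1).1
            rcases le_total a x with h7 | h7
            · rw [uIcc_of_le h7] at ht; linarith [ht.2]
            · rw [uIcc_of_ge h7] at ht; linarith [ht.2]
          simp only [Φ]
          rw [intervalIntegral.integral_congr (g := fun _ => (0 : ℝ)) this]; simp
        · have hax : a ≤ x := ((hKs hr1).1.trans hx).le
          have h8 : ∀ t, t ∉ Ioc a x → θ t = 0 := by
            intro t ht
            apply hθK
            intro htK
            exact ht ⟨(hKs htK).1, (hr2 htK).trans hx.le⟩
          simp only [Φ]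
          rw [intervalIntegral.integral_of_le hax,
            setIntegral_eq_integral_of_forall_compl_eq_zero h8, hθint]
      have hts : tsupport Φ ⊆ Icc s r := by
        refine closure_minimal ?_ isClosed_Icc
        intro x hx
        by_contra hx'
        exact hx (hΦ0 x hx')
      have hΦ2 : HasCompactSupport Φ :=
        isCompact_Icc.of_isClosed_subset (isClosed_tsupport _) hts
      have hΦ3 : tsupport Φ ⊆ Ioo a b := hts.trans
        (fun x hx => ⟨(hKs hs1).1.trans_le hx.1, hx.2.trans_lt (hKs hr1).2⟩)
      have hmain := hw Φ hΦ1 hΦ2 hΦ3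
      rw [hderiv] at hmain
      simp only [Pi.zero_apply, smul_zero, integral_zero, neg_zero] at hmain
      have e1 : ∀ x, θ x • u x = ψ x • u x - J • (ω x • u x) := fun x => by
        simp only [θ, sub_smul, mul_smul]
      simp only [e1] at hmain
      have hωu : Integrable (fun x => J • (ω x • u x)) (volume.restrict (Ioo a b)) :=
        (integrable_test_smul hω1.continuous hω2 hu).smul J
      rw [integral_sub (integrable_test_smul h1.continuous h2 hu) hωu, integral_smul] at hmain
      simp only [smul_sub]
      rw [integral_sub (integrable_test_smul h1.continuous h2 hu)
        (integrable_test_smul h1.continuous h2 (integrable_const c)), integral_smul_const]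
      have e2 : ∫ x in Ioo a b, ψ x = J :=
        setIntegral_eq_integral_of_forall_compl_eq_zero
          (fun x hx => image_eq_zero_of_notMem_tsupport (fun hx' => hx (h3 hx')))
      rw [e2]
      exact hmain)
  refine (ae_restrict_iff' measurableSet_Ioo).2 ?_
  filter_upwards [key] with x hx hx'
  exact sub_eq_zero.1 (hx hx')

/-- A function with an integrable weak derivative is a.e. equal to a constant plus the primitive
of that derivative. -/
theorem HasWeakDeriv.ae_eq_primitive (hab : a < b) (hw : HasWeakDeriv a b u g)
    (hu : Integrable u (volume.restrict (Ioo a b)))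
    (hg : Integrable g (volume.restrict (Ioo a b))) :
    ContinuousOn (fun x => ∫ t in a..x, g t) (Icc a b) ∧
    ∃ c : 𝕜, u =ᵐ[volume.restrict (Ioo a b)] fun x => c + ∫ t in a..x, g t := by
  have hg' : IntegrableOn g (Icc a b) := by
    rw [integrableOn_Icc_iff_integrableOn_Ioo]; exact hg
  have hcont : ContinuousOn (fun x => ∫ t in a..x, g t) (Icc a b) :=
    intervalIntegral.continuousOn_primitive_interval
      (by rw [uIcc_of_le hab.le]; exact hg') |>.mono (by rw [uIcc_of_le hab.le])
  refine ⟨hcont, ?_⟩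
  have hGi : Integrable (fun x => ∫ t in a..x, g t) (volume.restrict (Ioo a b)) :=
    (hcont.integrableOn_Icc).mono_set Ioo_subset_Icc_self
  have h0 : HasWeakDeriv a b (u + (-1 : 𝕜) • (fun x => ∫ t in a..x, g t)) 0 := by
    have := hw.add ((hasWeakDeriv_primitive hg).smul (-1 : 𝕜)) hu (hGi.smul _) hg (hg.smul _)
    refine this.congr (ae_eq_refl _) (Eventually.of_forall fun x => ?_)
    simp
  obtain ⟨c, hc⟩ := ae_eq_const_of_hasWeakDeriv_zero hab (hu.add (hGi.smul _)) h0
  refine ⟨c, ?_⟩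
  filter_upwards [hc] with x hx
  simp only [Pi.add_apply, Pi.smul_apply, smul_eq_mul] at hx
  rw [← hx]; ring

theorem MemSobolev.exists_continuousOn (hab : a < b) (hu : MemSobolev a b 1 u) :
    ∃ f : ℝ → 𝕜, ContinuousOn f (Icc a b) ∧ u =ᵐ[volume.restrict (Ioo a b)] f := by
  obtain ⟨h1, g, h2, h3⟩ := hu
  obtain ⟨k1, c, k2⟩ := h2.ae_eq_primitive hab (memLp_integrable h1) (memLp_integrable h3)
  exact ⟨_, continuousOn_const.add k1, k2⟩

theorem pointValue_eq (hab : a < b) {f : ℝ → 𝕜} (hf : ContinuousOn f (Icc a b))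
    (huf : u =ᵐ[volume.restrict (Ioo a b)] f) {x : ℝ} (hx : x ∈ Icc a b) :
    pointValue a b u x = f x := by
  have hex : ∃ c : 𝕜, HasPointValue a b u x c := ⟨f x, f, hf, huf, rfl⟩
  have e : pointValue a b u x = hex.choose := dif_pos hex
  obtain ⟨f', h1, h2, h3⟩ := hex.choose_spec
  rw [e, ← h3]
  have hae : f' =ᵐ[volume.restrict (Icc a b)] f := by
    rw [← Measure.restrict_congr_set (Ioo_ae_eq_Icc (μ := volume) (a := a) (b := b))]
    exact h2.symm.trans huf
  exact Measure.eqOn_Icc_of_ae_eq volume hab.ne hae h1 hf hx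

open Classical in
theorem pointValue_congr (huv : u =ᵐ[volume.restrict (Ioo a b)] v) (x : ℝ) :
    pointValue a b u x = pointValue a b v x := by
  have e : (fun c : 𝕜 => HasPointValue a b u x c) = fun c => HasPointValue a b v x c := by
    funext c
    exact propext ⟨fun ⟨f, h1, h2, h3⟩ => ⟨f, h1, huv.symm.trans h2, h3⟩,
      fun ⟨f, h1, h2, h3⟩ => ⟨f, h1, huv.trans h2, h3⟩⟩
  have key : ∀ P Q : 𝕜 → Prop, P = Q →
      (if h : ∃ g, P g then h.choose else 0) = if h : ∃ g, Q g then h.choose else 0 := by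
    rintro P _ rfl; rfl
  exact key _ _ e

theorem pointValue_add (hab : a < b) (hu : MemSobolev a b 1 u) (hv : MemSobolev a b 1 v)
    {x : ℝ} (hx : x ∈ Icc a b) :
    pointValue a b (u + v) x = pointValue a b u x + pointValue a b v x := by
  obtain ⟨f, f1, f2⟩ := hu.exists_continuousOn hab
  obtain ⟨g, g1, g2⟩ := hv.exists_continuousOn hab
  rw [pointValue_eq hab f1 f2 hx, pointValue_eq hab g1 g2 hx,
    pointValue_eq hab (f1.add g1) (f2.add g2) hx]
  rfl

theorem pointValue_smul (hab : a < b) (c : 𝕜) (hu : MemSobolev a b 1 u)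
    {x : ℝ} (hx : x ∈ Icc a b) :
    pointValue a b (c • u) x = c * pointValue a b u x := by
  obtain ⟨f, f1, f2⟩ := hu.exists_continuousOn hab
  rw [pointValue_eq hab f1 f2 hx, pointValue_eq hab (f1.const_smul c) (f2.const_smul c) hx]
  rfl

theorem pointValue_zero (hab : a < b) {x : ℝ} (hx : x ∈ Icc a b) :
    pointValue a b (0 : ℝ → 𝕜) x = 0 :=
  pointValue_eq hab (f := 0) continuousOn_const (ae_eq_refl _) hx

/-- A function in `H²(a, b)` with vanishing second derivative and vanishing boundary values
is zero. -/
theorem ae_eq_zero_of_second_deriv (hab : a < b) (hu : MemSobolev a b 2 u)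
    (h2 : (weakDeriv a b)^[2] u =ᵐ[volume.restrict (Ioo a b)] 0)
    (ha : pointValue a b u a = 0) (hb : pointValue a b u b = 0) :
    u =ᵐ[volume.restrict (Ioo a b)] 0 := by
  have s1 := hu.weakDeriv_spec
  have s2 := s1.2.weakDeriv_spec
  have hd0 : HasWeakDeriv a b (weakDeriv a b u) 0 := s2.1.congr (ae_eq_refl _) h2
  obtain ⟨c, hc⟩ := ae_eq_const_of_hasWeakDeriv_zero hab (memLp_integrable s1.2.memLp) hd0
  have hw : HasWeakDeriv a b u (fun _ => c) := s1.1.congr (ae_eq_refl _) hc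
  obtain ⟨k1, d, k2⟩ := hw.ae_eq_primitive hab (memLp_integrable hu.memLp) (integrable_const c)
  have hcont : ContinuousOn (fun x => d + ∫ _t in a..x, c) (Icc a b) := continuousOn_const.add k1
  rw [pointValue_eq hab hcont k2 (left_mem_Icc.2 hab.le)] at ha
  rw [pointValue_eq hab hcont k2 (right_mem_Icc.2 hab.le)] at hb
  rw [intervalIntegral.integral_same, add_zero] at ha
  rw [intervalIntegral.integral_const, ha, zero_add, smul_eq_zero] at hb
  have hc0 : c = 0 := hb.resolve_left (sub_ne_zero.2 hab.ne')
  filter_upwards [k2] with x hx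
  rw [hx, ha, hc0]; simp

end Basic

/-! ### The closed-loop beam model -/

/-- Parameters of the simply supported Euler–Bernoulli beam of length `l` with a spring-mass
system attached at `l₀`, together with `k` piezo actuators with shape functions `ψ j` and the
feedback gains. -/
structure BeamSystem where
  /-- length of the beam -/
  l : ℝ
  /-- attachment point of the spring-mass system -/
  l₀ : ℝ
  /-- Young modulus -/
  E : ℝ
  /-- cross-section moment of inertia -/
  I : ℝ
  /-- mass per unit length -/
  ρ : ℝ
  /-- mass of the moving part of the shaker -/
  m : ℝ
  /-- stiffness of the shaker -/
  ϰ : ℝ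
  /-- number of actuators -/
  k : ℕ
  /-- shape functions of the actuators -/
  ψ : Fin k → ℝ → ℝ
  /-- gains of the distributed controls -/
  α : Fin k → ℝ
  /-- gain of the lumped control -/
  α₀ : ℝ
  l₀_pos : 0 < l₀
  l₀_lt : l₀ < l
  E_pos : 0 < E
  I_pos : 0 < I
  ρ_pos : 0 < ρ
  m_pos : 0 < m
  ϰ_pos : 0 < ϰ
  α_pos : ∀ j, 0 < α j
  α₀_pos : 0 < α₀
  /-- `ψ j''` is twice continuously differentiable on `[0, l]` -/
  ψ_contDiffOn : ∀ j, ContDiffOn ℝ 4 (ψ j) (Icc 0 l)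
  /-- the support of `ψ j` contains none of the points `0`, `l₀`, `l` -/
  ψ_supp : ∀ j, Disjoint (closure {x ∈ Icc 0 l | ψ j x ≠ 0}) {0, l₀, l}

namespace BeamSystem

theorem l_pos (P : BeamSystem) : 0 < P.l := P.l₀_pos.trans P.l₀_lt

theorem l₀_mem (P : BeamSystem) : P.l₀ ∈ Icc 0 P.l := ⟨P.l₀_pos.le, P.l₀_lt.le⟩

/-- The second derivative of the shape function on `[0, l]`. -/
def ψdd (P : BeamSystem) (j : Fin P.k) : ℝ → ℝ :=
  iteratedDerivWithin 2 (P.ψ j) (Icc 0 P.l)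

/-- `L²(0, l)`. -/
abbrev L2 (P : BeamSystem) (𝕜 : Type*) [RCLike 𝕜] : Type _ :=
  Lp 𝕜 2 (volume.restrict (Ioo 0 P.l))

/-- The space `H̊²(0, l)` of the simply supported beam: functions `u ∈ H²(0, l)` such that
`u(0) = u(l) = 0`. -/
def H2₀ (P : BeamSystem) (𝕜 : Type*) [RCLike 𝕜] : Submodule 𝕜 (P.L2 𝕜) where
  carrier := {u | MemSobolev 0 P.l 2 (u : ℝ → 𝕜) ∧
    pointValue 0 P.l (u : ℝ → 𝕜) 0 = 0 ∧ pointValue 0 P.l (u : ℝ → 𝕜) P.l = 0}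
  zero_mem' := by
    have h0 := Lp.coeFn_zero 𝕜 2 (volume.restrict (Ioo 0 P.l))
    refine ⟨MemSobolev.zero.congr h0.symm, ?_, ?_⟩
    · rw [pointValue_congr h0, pointValue_zero P.l_pos (left_mem_Icc.2 P.l_pos.le)]
    · rw [pointValue_congr h0, pointValue_zero P.l_pos (right_mem_Icc.2 P.l_pos.le)]
  add_mem' := by
    rintro u v ⟨h1, h2, h3⟩ ⟨k1, k2, k3⟩
    have h0 := Lp.coeFn_add u v
    have h1' := h1.mono (m := 1) (by omega)
    have k1' := k1.mono (m := 1) (by omega)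
    refine ⟨(h1.add k1).congr h0.symm, ?_, ?_⟩
    · rw [pointValue_congr h0, pointValue_add P.l_pos h1' k1' (left_mem_Icc.2 P.l_pos.le), h2, k2,
        add_zero]
    · rw [pointValue_congr h0, pointValue_add P.l_pos h1' k1' (right_mem_Icc.2 P.l_pos.le), h3, k3,
        add_zero]
  smul_mem' := by
    rintro c u ⟨h1, h2, h3⟩
    have h0 := Lp.coeFn_smul c u
    have h1' := h1.mono (m := 1) (by omega)
    refine ⟨(h1.smul c).congr h0.symm, ?_, ?_⟩
    · rw [pointValue_congr h0, pointValue_smul P.l_pos c h1' (left_mem_Icc.2 P.l_pos.le), h2,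
        mul_zero]
    · rw [pointValue_congr h0, pointValue_smul P.l_pos c h1' (right_mem_Icc.2 P.l_pos.le), h3,
        mul_zero]

section

variable {𝕜 : Type*} [RCLike 𝕜] (P : BeamSystem)

/-- Evaluation `u ↦ u(l₀)` on `H̊²(0, l)`. -/
def evalL₀ : P.H2₀ 𝕜 →ₗ[𝕜] 𝕜 where
  toFun u := pointValue 0 P.l ((u : P.L2 𝕜) : ℝ → 𝕜) P.l₀
  map_add' u v := by
    rw [← pointValue_add P.l_pos (u.2.1.mono (by omega)) (v.2.1.mono (by omega)) P.l₀_mem]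
    exact pointValue_congr (Lp.coeFn_add _ _) _
  map_smul' c u := by
    rw [RingHom.id_apply, smul_eq_mul,
      ← pointValue_smul P.l_pos c (u.2.1.mono (by omega)) P.l₀_mem]
    exact pointValue_congr (Lp.coeFn_smul _ _) _

/-- The second derivative `u ↦ u''`, from `H̊²(0, l)` to `L²(0, l)`. -/
def secondDeriv : P.H2₀ 𝕜 →ₗ[𝕜] P.L2 𝕜 where
  toFun u := MemLp.toLp ((weakDeriv 0 P.l)^[2] ((u : P.L2 𝕜) : ℝ → 𝕜))
    (MemSobolev.iterate (n := 0) u.2.1).memLp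
  map_add' u v := by
    rw [← MemLp.toLp_add, MemLp.toLp_eq_toLp_iff]
    exact (iterate_weakDeriv_congr (Lp.coeFn_add _ _)).trans (iterate_weakDeriv_add u.2.1 v.2.1)
  map_smul' c u := by
    rw [RingHom.id_apply, ← MemLp.toLp_const_smul, MemLp.toLp_eq_toLp_iff]
    exact (iterate_weakDeriv_congr (Lp.coeFn_smul _ _)).trans (iterate_weakDeriv_smul c u.2.1)

theorem secondDeriv_eq_zero {u : P.H2₀ 𝕜} (hu : P.secondDeriv u = 0) : u = 0 := by
  have h1 : (weakDeriv 0 P.l)^[2] ((u : P.L2 𝕜) : ℝ → 𝕜) =ᵐ[volume.restrict (Ioo 0 P.l)] 0 := by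
    have h2 := MemLp.coeFn_toLp (MemSobolev.iterate (n := 0) (i := 2) u.2.1).memLp
    have h3 : (P.secondDeriv u : ℝ → 𝕜) =ᵐ[volume.restrict (Ioo 0 P.l)] 0 := by
      rw [hu]; exact Lp.coeFn_zero _ _ _
    exact h2.symm.trans h3
  have h4 := ae_eq_zero_of_second_deriv P.l_pos u.2.1 h1 u.2.2.1 u.2.2.2
  exact Subtype.ext (Lp.ext (h4.trans (Lp.coeFn_zero _ _ _).symm))

/-- The second derivative of the shape function as an element of `L²(0, l)`. -/
theorem memLp_ψdd (j : Fin P.k) :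
    MemLp (fun x => ((P.ψdd j x : ℝ) : 𝕜)) 2 (volume.restrict (Ioo 0 P.l)) := by
  have hc : ContinuousOn (P.ψdd j) (Icc 0 P.l) :=
    (P.ψ_contDiffOn j).continuousOn_iteratedDerivWithin (by norm_cast)
      (uniqueDiffOn_Icc P.l_pos)
  have hc' : ContinuousOn (fun x => ((P.ψdd j x : ℝ) : 𝕜)) (Icc 0 P.l) :=
    RCLike.continuous_ofReal.comp_continuousOn hc
  obtain ⟨C, hC⟩ := isCompact_Icc.exists_bound_of_continuousOn hc'
  refine MemLp.of_bound (C := C)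
    ((hc'.mono Ioo_subset_Icc_self).aestronglyMeasurable measurableSet_Ioo) ?_
  exact (ae_restrict_iff' measurableSet_Ioo).2
    (Eventually.of_forall fun x hx => hC x (Ioo_subset_Icc_self hx))

end

/-- The space `X = H̊²(0, l) × L²(0, l) × 𝕜²`, with elements `(u, v, p, q)`. -/
def State (P : BeamSystem) (𝕜 : Type*) [RCLike 𝕜] : Type _ :=
  P.H2₀ 𝕜 × P.L2 𝕜 × 𝕜 × 𝕜

namespace State

variable {𝕜 : Type*} [RCLike 𝕜] {P : BeamSystem}

instance : AddCommGroup (P.State 𝕜) :=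
  inferInstanceAs (AddCommGroup (P.H2₀ 𝕜 × P.L2 𝕜 × 𝕜 × 𝕜))

instance : Module 𝕜 (P.State 𝕜) :=
  inferInstanceAs (Module 𝕜 (P.H2₀ 𝕜 × P.L2 𝕜 × 𝕜 × 𝕜))

/-- The state `(u, v, p, q)`. -/
def mk (u : P.H2₀ 𝕜) (v : P.L2 𝕜) (p q : 𝕜) : P.State 𝕜 := (u, v, p, q)

/-- The component `u` (deflection). -/
def u (ξ : P.State 𝕜) : P.H2₀ 𝕜 := ξ.1

/-- The component `v` (velocity). -/
def v (ξ : P.State 𝕜) : P.L2 𝕜 := ξ.2.1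

/-- The component `p` (position of the attached mass). -/
def p (ξ : P.State 𝕜) : 𝕜 := ξ.2.2.1

/-- The component `q` (velocity of the attached mass). -/
def q (ξ : P.State 𝕜) : 𝕜 := ξ.2.2.2

@[ext] theorem ext {ξ η : P.State 𝕜} (hu : ξ.u = η.u) (hv : ξ.v = η.v) (hp : ξ.p = η.p)
    (hq : ξ.q = η.q) : ξ = η :=
  Prod.ext hu (Prod.ext hv (Prod.ext hp hq))

@[simp] theorem u_mk (u : P.H2₀ 𝕜) (v : P.L2 𝕜) (p q : 𝕜) : (mk u v p q).u = u := rfl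
@[simp] theorem v_mk (u : P.H2₀ 𝕜) (v : P.L2 𝕜) (p q : 𝕜) : (mk u v p q).v = v := rfl
@[simp] theorem p_mk (u : P.H2₀ 𝕜) (v : P.L2 𝕜) (p q : 𝕜) : (mk u v p q).p = p := rfl
@[simp] theorem q_mk (u : P.H2₀ 𝕜) (v : P.L2 𝕜) (p q : 𝕜) : (mk u v p q).q = q := rfl
@[simp] theorem u_add (ξ η : P.State 𝕜) : (ξ + η).u = ξ.u + η.u := rfl
@[simp] theorem v_add (ξ η : P.State 𝕜) : (ξ + η).v = ξ.v + η.v := rfl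
@[simp] theorem p_add (ξ η : P.State 𝕜) : (ξ + η).p = ξ.p + η.p := rfl
@[simp] theorem q_add (ξ η : P.State 𝕜) : (ξ + η).q = ξ.q + η.q := rfl
@[simp] theorem u_smul (c : 𝕜) (ξ : P.State 𝕜) : (c • ξ).u = c • ξ.u := rfl
@[simp] theorem v_smul (c : 𝕜) (ξ : P.State 𝕜) : (c • ξ).v = c • ξ.v := rfl
@[simp] theorem p_smul (c : 𝕜) (ξ : P.State 𝕜) : (c • ξ).p = c * ξ.p := rfl
@[simp] theorem q_smul (c : 𝕜) (ξ : P.State 𝕜) : (c • ξ).q = c * ξ.q := rfl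
@[simp] theorem u_zero : (0 : P.State 𝕜).u = 0 := rfl
@[simp] theorem v_zero : (0 : P.State 𝕜).v = 0 := rfl
@[simp] theorem p_zero : (0 : P.State 𝕜).p = 0 := rfl
@[simp] theorem q_zero : (0 : P.State 𝕜).q = 0 := rfl

/-- The energy inner product
`∫ (E I u₁'' u₂'' + ρ v₁ v₂) dx + ϰ p₁ p₂ + m q₁ q₂`
(conjugate-linear in the first argument, as everywhere in Mathlib). -/
@[reducible] def core : InnerProductSpace.Core 𝕜 (P.State 𝕜) where
  inner ξ η := ((P.E * P.I : ℝ) : 𝕜) * inner 𝕜 (P.secondDeriv ξ.u) (P.secondDeriv η.u) +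
    (P.ρ : 𝕜) * inner 𝕜 ξ.v η.v + (P.ϰ : 𝕜) * inner 𝕜 ξ.p η.p + (P.m : 𝕜) * inner 𝕜 ξ.q η.q
  conj_inner_symm ξ η := by
    simp only [map_add, map_mul, RCLike.conj_ofReal, inner_conj_symm]
  re_inner_nonneg ξ := by
    have h1 := P.E_pos; have h2 := P.I_pos; have h3 := P.ρ_pos
    have h4 := P.ϰ_pos; have h5 := P.m_pos
    simp only [map_add, RCLike.re_ofReal_mul, inner_self_eq_norm_sq]
    positivity
  add_left ξ η ζ := by
    simp only [u_add, v_add, p_add, q_add, map_add, inner_add_left]; ring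
  smul_left ξ η c := by
    simp only [u_smul, v_smul, p_smul, q_smul, map_smul, ← smul_eq_mul, inner_smul_left]
    simp only [smul_eq_mul]; ring
  definite ξ h := by
    have h1 := mul_pos P.E_pos P.I_pos; have h3 := P.ρ_pos
    have h4 := P.ϰ_pos; have h5 := P.m_pos
    have hre := congrArg RCLike.re h
    simp only [map_add, RCLike.re_ofReal_mul, inner_self_eq_norm_sq, map_zero] at hre
    have n1 : 0 ≤ P.E * P.I * ‖P.secondDeriv ξ.u‖ ^ 2 := by positivity
    have n2 : 0 ≤ P.ρ * ‖ξ.v‖ ^ 2 := by positivity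
    have n3 : 0 ≤ P.ϰ * ‖ξ.p‖ ^ 2 := by positivity
    have n4 : 0 ≤ P.m * ‖ξ.q‖ ^ 2 := by positivity
    have z1 : P.E * P.I * ‖P.secondDeriv ξ.u‖ ^ 2 = 0 := by linarith
    have z2 : P.ρ * ‖ξ.v‖ ^ 2 = 0 := by linarith
    have z3 : P.ϰ * ‖ξ.p‖ ^ 2 = 0 := by linarith
    have z4 : P.m * ‖ξ.q‖ ^ 2 = 0 := by linarith
    simp only [mul_eq_zero, h1.ne', h3.ne', h4.ne', h5.ne', false_or, pow_eq_zero_iff,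
      ne_eq, OfNat.ofNat_ne_zero, not_false_eq_true, norm_eq_zero] at z1 z2 z3 z4
    refine ext (P.secondDeriv_eq_zero ?_) z2 z3 z4
    simpa [P.E_pos.ne', P.I_pos.ne'] using z1

instance : NormedAddCommGroup (P.State 𝕜) :=
  InnerProductSpace.Core.toNormedAddCommGroup (cd := core)

instance : InnerProductSpace 𝕜 (P.State 𝕜) :=
  InnerProductSpace.ofCore core.toCore

end State

section Operator

variable {𝕜 : Type*} [RCLike 𝕜] (P : BeamSystem)

/-- The distributed feedback control `M_j = -α_j ∫₀ˡ ψ_j'' v dx`. -/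
def distControl (j : Fin P.k) : P.L2 𝕜 →ₗ[𝕜] 𝕜 where
  toFun v := -(P.α j : 𝕜) * ∫ x in Ioo 0 P.l, (P.ψdd j x : 𝕜) * v x
  map_add' v w := by
    have e : ∫ x in Ioo 0 P.l, (P.ψdd j x : 𝕜) * (v + w : P.L2 𝕜) x =
        ∫ x in Ioo 0 P.l, ((P.ψdd j x : 𝕜) * v x + (P.ψdd j x : 𝕜) * w x) := by
      refine integral_congr_ae ?_
      filter_upwards [Lp.coeFn_add v w] with x hx
      rw [hx, Pi.add_apply, mul_add]
    have i1 : Integrable (fun x => (P.ψdd j x : 𝕜) * v x) (volume.restrict (Ioo 0 P.l)) :=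
      (P.memLp_ψdd j).integrable_mul (Lp.memLp v)
    have i2 : Integrable (fun x => (P.ψdd j x : 𝕜) * w x) (volume.restrict (Ioo 0 P.l)) :=
      (P.memLp_ψdd j).integrable_mul (Lp.memLp w)
    rw [e, integral_add i1 i2, mul_add]
  map_smul' c v := by
    have e : ∫ x in Ioo 0 P.l, (P.ψdd j x : 𝕜) * (c • v : P.L2 𝕜) x =
        ∫ x in Ioo 0 P.l, c * ((P.ψdd j x : 𝕜) * v x) := by
      refine integral_congr_ae ?_
      filter_upwards [Lp.coeFn_smul c v] with x hx
      rw [hx, Pi.smul_apply, smul_eq_mul]; ring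
    rw [e, integral_const_mul, RingHom.id_apply, smul_eq_mul]; ring

/-- The lumped feedback control `F = -α₀ q`. -/
def lumpedControl (q : 𝕜) : 𝕜 := -(P.α₀ : 𝕜) * q

/-- The condition `u ∈ H⁴(0, l₀) ∩ H⁴(l₀, l)`. -/
def PiecewiseH4 (u : ℝ → 𝕜) : Prop :=
  MemSobolev 0 P.l₀ 4 u ∧ MemSobolev P.l₀ P.l 4 u

variable {P}

theorem ae_left {β : Type*} {f g : ℝ → β} (h : f =ᵐ[volume.restrict (Ioo 0 P.l)] g) :
    f =ᵐ[volume.restrict (Ioo 0 P.l₀)] g :=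
  ae_restrict_of_ae_restrict_of_subset (Ioo_subset_Ioo_right P.l₀_lt.le) h

theorem ae_right {β : Type*} {f g : ℝ → β} (h : f =ᵐ[volume.restrict (Ioo 0 P.l)] g) :
    f =ᵐ[volume.restrict (Ioo P.l₀ P.l)] g :=
  ae_restrict_of_ae_restrict_of_subset (Ioo_subset_Ioo_left P.l₀_pos.le) h

variable (P)

/-- The value at `x ∈ [0, l₀]` of the `i`-th derivative of the restriction of `u` to `(0, l₀)`;
for `x = l₀` this is the one-sided limit `u⁽ⁱ⁾(l₀ - 0)`. -/
def leftDerivAt (i : ℕ) (u : ℝ → 𝕜) (x : ℝ) : 𝕜 :=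
  pointValue 0 P.l₀ ((weakDeriv 0 P.l₀)^[i] u) x

/-- The value at `x ∈ [l₀, l]` of the `i`-th derivative of the restriction of `u` to `(l₀, l)`;
for `x = l₀` this is the one-sided limit `u⁽ⁱ⁾(l₀ + 0)`. -/
def rightDerivAt (i : ℕ) (u : ℝ → 𝕜) (x : ℝ) : 𝕜 :=
  pointValue P.l₀ P.l ((weakDeriv P.l₀ P.l)^[i] u) x

variable {P}

theorem leftDerivAt_add {i : ℕ} {u v : P.L2 𝕜} (hi : i ≤ 3) (hu : P.PiecewiseH4 u)
    (hv : P.PiecewiseH4 v) {x : ℝ} (hx : x ∈ Icc 0 P.l₀) :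
    P.leftDerivAt i (u + v : P.L2 𝕜) x = P.leftDerivAt i u x + P.leftDerivAt i v x := by
  unfold leftDerivAt
  rw [← pointValue_add P.l₀_pos (MemSobolev.iterate (hu.1.mono (by omega)))
    (MemSobolev.iterate (hv.1.mono (by omega))) hx]
  exact pointValue_congr ((iterate_weakDeriv_congr (ae_left (Lp.coeFn_add u v))).trans
    (iterate_weakDeriv_add (hu.1.mono (by omega)) (hv.1.mono (by omega)))) x

theorem rightDerivAt_add {i : ℕ} {u v : P.L2 𝕜} (hi : i ≤ 3) (hu : P.PiecewiseH4 u)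
    (hv : P.PiecewiseH4 v) {x : ℝ} (hx : x ∈ Icc P.l₀ P.l) :
    P.rightDerivAt i (u + v : P.L2 𝕜) x = P.rightDerivAt i u x + P.rightDerivAt i v x := by
  unfold rightDerivAt
  rw [← pointValue_add P.l₀_lt (MemSobolev.iterate (hu.2.mono (by omega)))
    (MemSobolev.iterate (hv.2.mono (by omega))) hx]
  exact pointValue_congr ((iterate_weakDeriv_congr (ae_right (Lp.coeFn_add u v))).trans
    (iterate_weakDeriv_add (hu.2.mono (by omega)) (hv.2.mono (by omega)))) x

theorem leftDerivAt_smul {i : ℕ} (c : 𝕜) {u : P.L2 𝕜} (hi : i ≤ 3) (hu : P.PiecewiseH4 u)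
    {x : ℝ} (hx : x ∈ Icc 0 P.l₀) :
    P.leftDerivAt i (c • u : P.L2 𝕜) x = c * P.leftDerivAt i u x := by
  unfold leftDerivAt
  rw [← pointValue_smul P.l₀_pos c (MemSobolev.iterate (hu.1.mono (by omega))) hx]
  exact pointValue_congr ((iterate_weakDeriv_congr (ae_left (Lp.coeFn_smul c u))).trans
    (iterate_weakDeriv_smul c (hu.1.mono (by omega)))) x

theorem rightDerivAt_smul {i : ℕ} (c : 𝕜) {u : P.L2 𝕜} (hi : i ≤ 3) (hu : P.PiecewiseH4 u)
    {x : ℝ} (hx : x ∈ Icc P.l₀ P.l) :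
    P.rightDerivAt i (c • u : P.L2 𝕜) x = c * P.rightDerivAt i u x := by
  unfold rightDerivAt
  rw [← pointValue_smul P.l₀_lt c (MemSobolev.iterate (hu.2.mono (by omega))) hx]
  exact pointValue_congr ((iterate_weakDeriv_congr (ae_right (Lp.coeFn_smul c u))).trans
    (iterate_weakDeriv_smul c (hu.2.mono (by omega)))) x

theorem PiecewiseH4.add {u v : P.L2 𝕜} (hu : P.PiecewiseH4 u) (hv : P.PiecewiseH4 v) :
    P.PiecewiseH4 (u + v : P.L2 𝕜) :=
  ⟨(hu.1.add hv.1).congr (ae_left (Lp.coeFn_add u v)).symm,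
    (hu.2.add hv.2).congr (ae_right (Lp.coeFn_add u v)).symm⟩

theorem PiecewiseH4.smul (c : 𝕜) {u : P.L2 𝕜} (hu : P.PiecewiseH4 u) :
    P.PiecewiseH4 (c • u : P.L2 𝕜) :=
  ⟨(hu.1.smul c).congr (ae_left (Lp.coeFn_smul c u)).symm,
    (hu.2.smul c).congr (ae_right (Lp.coeFn_smul c u)).symm⟩

theorem PiecewiseH4.zero : P.PiecewiseH4 ((0 : P.L2 𝕜) : ℝ → 𝕜) :=
  ⟨MemSobolev.zero.congr (ae_left (Lp.coeFn_zero 𝕜 2 _)).symm,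
    MemSobolev.zero.congr (ae_right (Lp.coeFn_zero 𝕜 2 _)).symm⟩

variable (P)

/-- The domain `D(Ã)`: all `(u, v, p, q) ∈ X` with `u ∈ H⁴(0, l₀) ∩ H⁴(l₀, l)`,
`u''(0) = u''(l) = 0`, `u''(l₀ - 0) = u''(l₀ + 0)`, `v ∈ H̊²(0, l)`, `p = u(l₀)`, `q = v(l₀)`. -/
def domain (𝕜 : Type*) [RCLike 𝕜] : Submodule 𝕜 (P.State 𝕜) where
  carrier := {ξ | P.PiecewiseH4 (ξ.u : P.L2 𝕜) ∧
    P.leftDerivAt 2 (ξ.u : P.L2 𝕜) 0 = 0 ∧ P.rightDerivAt 2 (ξ.u : P.L2 𝕜) P.l = 0 ∧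
    P.leftDerivAt 2 (ξ.u : P.L2 𝕜) P.l₀ = P.rightDerivAt 2 (ξ.u : P.L2 𝕜) P.l₀ ∧
    (∃ hv : ξ.v ∈ P.H2₀ 𝕜, ξ.q = P.evalL₀ ⟨ξ.v, hv⟩) ∧ ξ.p = P.evalL₀ ξ.u}
  zero_mem' := by
    have hz : ∀ {x}, x ∈ Icc 0 P.l₀ → P.leftDerivAt 2 ((0 : P.L2 𝕜) : ℝ → 𝕜) x = 0 := by
      intro x hx
      have := leftDerivAt_smul (i := 2) (0 : 𝕜) (by omega) (PiecewiseH4.zero (P := P)) hx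
      rwa [zero_smul, zero_mul] at this
    have hz' : ∀ {x}, x ∈ Icc P.l₀ P.l → P.rightDerivAt 2 ((0 : P.L2 𝕜) : ℝ → 𝕜) x = 0 := by
      intro x hx
      have := rightDerivAt_smul (i := 2) (0 : 𝕜) (by omega) (PiecewiseH4.zero (P := P)) hx
      rwa [zero_smul, zero_mul] at this
    have e : ∀ h, (⟨0, h⟩ : P.H2₀ 𝕜) = 0 := fun _ => rfl
    refine ⟨PiecewiseH4.zero, hz (left_mem_Icc.2 P.l₀_pos.le), hz' (right_mem_Icc.2 P.l₀_lt.le),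
      (hz (right_mem_Icc.2 P.l₀_pos.le)).trans (hz' (left_mem_Icc.2 P.l₀_lt.le)).symm,
      ⟨Submodule.zero_mem _, ?_⟩, ?_⟩
    · simp [e]
    · simp
  add_mem' := by
    rintro ξ η ⟨h1, h2, h3, h4, ⟨h5, h6⟩, h7⟩ ⟨k1, k2, k3, k4, ⟨k5, k6⟩, k7⟩
    refine ⟨h1.add k1, ?_, ?_, ?_, ⟨Submodule.add_mem _ h5 k5, ?_⟩, ?_⟩
    · rw [State.u_add, Submodule.coe_add,
        leftDerivAt_add (by omega) h1 k1 (left_mem_Icc.2 P.l₀_pos.le), h2, k2, add_zero]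
    · rw [State.u_add, Submodule.coe_add,
        rightDerivAt_add (by omega) h1 k1 (right_mem_Icc.2 P.l₀_lt.le), h3, k3, add_zero]
    · rw [State.u_add, Submodule.coe_add,
        leftDerivAt_add (by omega) h1 k1 (right_mem_Icc.2 P.l₀_pos.le),
        rightDerivAt_add (by omega) h1 k1 (left_mem_Icc.2 P.l₀_lt.le), h4, k4]
    · rw [State.q_add, h6, k6, ← map_add]; rfl
    · rw [State.p_add, h7, k7, ← map_add]; rfl
  smul_mem' := by
    rintro c ξ ⟨h1, h2, h3, h4, ⟨h5, h6⟩, h7⟩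
    refine ⟨h1.smul c, ?_, ?_, ?_, ⟨Submodule.smul_mem _ c h5, ?_⟩, ?_⟩
    · rw [State.u_smul, Submodule.coe_smul,
        leftDerivAt_smul c (by omega) h1 (left_mem_Icc.2 P.l₀_pos.le), h2, mul_zero]
    · rw [State.u_smul, Submodule.coe_smul,
        rightDerivAt_smul c (by omega) h1 (right_mem_Icc.2 P.l₀_lt.le), h3, mul_zero]
    · rw [State.u_smul, Submodule.coe_smul,
        leftDerivAt_smul c (by omega) h1 (right_mem_Icc.2 P.l₀_pos.le),
        rightDerivAt_smul c (by omega) h1 (left_mem_Icc.2 P.l₀_lt.le), h4]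
    · rw [State.q_smul, h6, ← smul_eq_mul, ← map_smul]; rfl
    · rw [State.p_smul, h7, ← smul_eq_mul, ← map_smul]; rfl

/-- The piecewise fourth derivative of `u` on `(0, l₀) ∪ (l₀, l)`. -/
def fourthDerivFun (u : ℝ → 𝕜) : ℝ → 𝕜 :=
  (Ioo 0 P.l₀).indicator ((weakDeriv 0 P.l₀)^[4] u) +
    (Ioo P.l₀ P.l).indicator ((weakDeriv P.l₀ P.l)^[4] u)

variable {P}

theorem memLp_fourthDerivFun {u : ℝ → 𝕜} (hu : P.PiecewiseH4 u) :
    MemLp (P.fourthDerivFun u) 2 (volume.restrict (Ioo 0 P.l)) := by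
  refine MemLp.add ?_ ?_
  · rw [memLp_indicator_iff_restrict measurableSet_Ioo,
      Measure.restrict_restrict_of_subset (Ioo_subset_Ioo_right P.l₀_lt.le)]
    exact (MemSobolev.iterate (n := 0) hu.1).memLp
  · rw [memLp_indicator_iff_restrict measurableSet_Ioo,
      Measure.restrict_restrict_of_subset (Ioo_subset_Ioo_left P.l₀_pos.le)]
    exact (MemSobolev.iterate (n := 0) hu.2).memLp

theorem ae_restrict_indicator {s : Set ℝ} (hs : MeasurableSet s) {f g : ℝ → 𝕜}
    (h : f =ᵐ[volume.restrict s] g) (t : Set ℝ) :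
    s.indicator f =ᵐ[volume.restrict t] s.indicator g := by
  refine ae_restrict_of_ae ?_
  filter_upwards [(ae_restrict_iff' hs).1 h] with x hx
  by_cases hxs : x ∈ s
  · rw [indicator_of_mem hxs, indicator_of_mem hxs, hx hxs]
  · rw [indicator_of_notMem hxs, indicator_of_notMem hxs]

variable (P)

/-- The map `ξ ↦ u''''` from `D(Ã)` to `L²(0, l)`. -/
def fourthDeriv : P.domain 𝕜 →ₗ[𝕜] P.L2 𝕜 where
  toFun ξ := MemLp.toLp (P.fourthDerivFun ((ξ : P.State 𝕜).u : P.L2 𝕜))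
    (memLp_fourthDerivFun ξ.2.1)
  map_add' ξ η := by
    rw [← MemLp.toLp_add, MemLp.toLp_eq_toLp_iff]
    have h1 := (iterate_weakDeriv_congr (i := 4) (ae_left (Lp.coeFn_add
      ((ξ : P.State 𝕜).u : P.L2 𝕜) ((η : P.State 𝕜).u : P.L2 𝕜)))).trans
      (iterate_weakDeriv_add ξ.2.1.1 η.2.1.1)
    have h2 := (iterate_weakDeriv_congr (i := 4) (ae_right (Lp.coeFn_add
      ((ξ : P.State 𝕜).u : P.L2 𝕜) ((η : P.State 𝕜).u : P.L2 𝕜)))).trans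
      (iterate_weakDeriv_add ξ.2.1.2 η.2.1.2)
    refine ((ae_restrict_indicator measurableSet_Ioo h1 (Ioo 0 P.l)).add
      (ae_restrict_indicator measurableSet_Ioo h2 (Ioo 0 P.l))).trans (Eventually.of_forall ?_)
    intro x
    simp only [fourthDerivFun, Pi.add_apply, indicator_add']
    ring
  map_smul' c ξ := by
    rw [RingHom.id_apply, ← MemLp.toLp_const_smul, MemLp.toLp_eq_toLp_iff]
    have h1 := (iterate_weakDeriv_congr (i := 4) (ae_left (Lp.coeFn_smul c
      ((ξ : P.State 𝕜).u : P.L2 𝕜)))).trans (iterate_weakDeriv_smul c ξ.2.1.1)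
    have h2 := (iterate_weakDeriv_congr (i := 4) (ae_right (Lp.coeFn_smul c
      ((ξ : P.State 𝕜).u : P.L2 𝕜)))).trans (iterate_weakDeriv_smul c ξ.2.1.2)
    refine ((ae_restrict_indicator measurableSet_Ioo h1 (Ioo 0 P.l)).add
      (ae_restrict_indicator measurableSet_Ioo h2 (Ioo 0 P.l))).trans (Eventually.of_forall ?_)
    intro x
    simp only [fourthDerivFun, Pi.add_apply, Pi.smul_apply, smul_add, indicator_apply]
    split_ifs <;> simp

/-- The shear force jump `L = E I (u'''(l₀ - 0) - u'''(l₀ + 0))`. -/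
def shearJump (ξ : P.domain 𝕜) : 𝕜 :=
  ((P.E * P.I : ℝ) : 𝕜) * (P.leftDerivAt 3 ((ξ : P.State 𝕜).u : P.L2 𝕜) P.l₀ -
    P.rightDerivAt 3 ((ξ : P.State 𝕜).u : P.L2 𝕜) P.l₀)

theorem shearJump_add (ξ η : P.domain 𝕜) :
    P.shearJump (ξ + η) = P.shearJump ξ + P.shearJump η := by
  unfold shearJump
  rw [Submodule.coe_add, State.u_add, Submodule.coe_add,
    leftDerivAt_add (by omega) ξ.2.1 η.2.1 (right_mem_Icc.2 P.l₀_pos.le),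
    rightDerivAt_add (by omega) ξ.2.1 η.2.1 (left_mem_Icc.2 P.l₀_lt.le)]
  ring

theorem shearJump_smul (c : 𝕜) (ξ : P.domain 𝕜) :
    P.shearJump (c • ξ) = c * P.shearJump ξ := by
  unfold shearJump
  rw [Submodule.coe_smul, State.u_smul, Submodule.coe_smul,
    leftDerivAt_smul c (by omega) ξ.2.1 (right_mem_Icc.2 P.l₀_pos.le),
    rightDerivAt_smul c (by omega) ξ.2.1 (left_mem_Icc.2 P.l₀_lt.le)]
  ring

/-- `ψ_j''` as an element of `L²(0, l)`. -/
def ψL2 (𝕜 : Type*) [RCLike 𝕜] (j : Fin P.k) : P.L2 𝕜 :=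
  MemLp.toLp (fun x => ((P.ψdd j x : ℝ) : 𝕜)) (P.memLp_ψdd j)

/-- The generator `Ã` of the closed-loop system, with domain `D(Ã)`:
`Ã(u, v, p, q) = (v, -(E I / ρ) u'''' + (1 / ρ) ∑ ψ_j'' M_j, q, (L - ϰ p + F) / m)`. -/
def generator (𝕜 : Type*) [RCLike 𝕜] : P.State 𝕜 →ₗ.[𝕜] P.State 𝕜 where
  domain := P.domain 𝕜
  toFun :=
    { toFun := fun ξ => State.mk
        ⟨(ξ : P.State 𝕜).v, ξ.2.2.2.2.2.1.choose⟩
        (-((P.E * P.I / P.ρ : ℝ) : 𝕜) • P.fourthDeriv ξ +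
          ((1 / P.ρ : ℝ) : 𝕜) • ∑ j, P.distControl j (ξ : P.State 𝕜).v • P.ψL2 𝕜 j)
        (ξ : P.State 𝕜).q
        (((1 / P.m : ℝ) : 𝕜) * (P.shearJump ξ - (P.ϰ : 𝕜) * (ξ : P.State 𝕜).p +
          P.lumpedControl (ξ : P.State 𝕜).q))
      map_add' := fun ξ η => by
        refine State.ext rfl ?_ rfl ?_
        · simp only [State.v_mk, State.v_add, Submodule.coe_add, map_add, add_smul,
            Finset.sum_add_distrib, smul_add]
          abel
        · simp only [State.q_mk, State.q_add, Submodule.coe_add, State.p_add, shearJump_add,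
            lumpedControl]
          ring
      map_smul' := fun c ξ => by
        refine State.ext rfl ?_ rfl ?_
        · simp only [State.v_mk, State.v_smul, Submodule.coe_smul, map_smul, RingHom.id_apply,
            smul_add, smul_assoc, Finset.smul_sum]
          simp only [smul_comm c]
        · simp only [State.q_mk, State.q_smul, Submodule.coe_smul, State.p_smul, shearJump_smul,
            lumpedControl, RingHom.id_apply]
          ring }

/-- The operator `I - λ Ã` with domain `D(Ã)`. -/
def idSubSmul (𝕜 : Type*) [RCLike 𝕜] (lam : ℝ) : P.State 𝕜 →ₗ.[𝕜] P.State 𝕜 where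
  domain := (P.generator 𝕜).domain
  toFun := (P.generator 𝕜).domain.subtype - (lam : 𝕜) • (P.generator 𝕜).toFun

/-- The resolvent `R_λ(Ã) = (I - λ Ã)⁻¹`, an operator in `X` whose domain is the range of
`I - λ Ã` (meaningful when `I - λ Ã` is injective). -/
def resolvent (𝕜 : Type*) [RCLike 𝕜] (lam : ℝ) : P.State 𝕜 →ₗ.[𝕜] P.State 𝕜 :=
  (P.idSubSmul 𝕜 lam).inverse

/-- The states `(u, v, p, q) ∈ X` with `p = u(l₀)`. -/
def compatible (𝕜 : Type*) [RCLike 𝕜] : Submodule 𝕜 (P.State 𝕜) where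
  carrier := {ξ | ξ.p = P.evalL₀ ξ.u}
  zero_mem' := by simp
  add_mem' := by
    intro ξ η hξ hη
    simp only [mem_ofPred_eq] at hξ hη ⊢
    rw [State.p_add, State.u_add, map_add, hξ, hη]
  smul_mem' := by
    intro c ξ hξ
    simp only [mem_ofPred_eq] at hξ ⊢
    rw [State.p_smul, State.u_smul, map_smul, hξ, smul_eq_mul]

variable {P}

/-- `ξ` is a trajectory on `[0, ∞)` of `dξ/dt = Ã ξ`, i.e. a mild solution: `ξ` is continuous and
its primitive `η(t) = ∫₀ᵗ ξ(s) ds` satisfies `η(t) ∈ D(Ã)` and `ξ(t) = ξ(0) + Ã η(t)`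
for all `t ≥ 0`. -/
def IsTrajectory (ξ : ℝ → P.State 𝕜) : Prop :=
  ContinuousOn ξ (Ici 0) ∧
  ∃ η : ℝ → P.State 𝕜, η 0 = 0 ∧
    (∀ t, 0 ≤ t → Tendsto (fun s : ℝ => (((s - t)⁻¹ : ℝ) : 𝕜) • (η s - η t))
      (𝓝[Ici 0 \ {t}] t) (𝓝 (ξ t))) ∧
    ∀ t, 0 ≤ t → ∃ h : η t ∈ (P.generator 𝕜).domain,
      ξ t = ξ 0 + P.generator 𝕜 ⟨η t, h⟩

end Operator

end BeamSystem

end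

end ShakerBeam

/-!
The generator `Ã` is dissipative: integrating by parts in the energy inner product, the elastic
terms and the shear force at `l₀` cancel in the real part, and only the damping
`-∑ α_j |∫ ψ_j'' v|² - α₀ |q|²` remains (`re_inner_generator`). Hence `I - λ Ã` is injective and
its inverse is a contraction.

Everything on the beam is expressed through the Dirichlet problem `u'' = g`, `u(0) = u(l) = 0`.
Its solution operator is symmetric (`inner_dirichlet_comm`) and compact in `L²(0, l)` by
Arzelà–Ascoli (`isCompactOperator_dirichlet`), and `u(l₀) = -l⁻¹ ⟨h, u''⟩` for the hat function
`h` with peak at `l₀` (`inner_hat_secondDeriv`). A state in `D(Ã)` is exactly one with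
`u'' = w + β h`, where `w` solves the Dirichlet problem with right-hand side `u''''` (taken
piecewise) and `E I l β` is the shear force jump (`domainMk_mem`, `eq_domainMk`). In these terms
`Ã ξ = y` is solved explicitly for every `y` in `X₀`, and the solution operator is compact
(`generator_inverse`, `isCompactOperator_inverse`). If `λ > 0` were an eigenvalue of this inverse,
`I - λ Ã` would not be injective, so the Fredholm alternative gives the compact resolvents on all
of `X₀` (`IsDissipative.exists_isResolventOn`).

For a mild solution `ξ`, the function `J ξ` with `J = (I - μ Ã)⁻¹` is a classical solution, so its
norm decreases by dissipativity; letting `μ → 0`, also `‖ξ(t)‖ ≤ ‖ξ(0)‖`. Applied to the mild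
solution `ξ - J ξ` this gives `‖ξ(t) - J ξ(t)‖ ≤ ‖ξ(0) - J ξ(0)‖`, which is small for small `μ`
uniformly in `t`, while `J ξ(t)` stays in the image of a ball under the compact operator `J`.
Hence the trajectory is totally bounded. No density of `D(Ã)` in `X₀` and no semigroup generation
theorem is needed, since `ξ(t)`, as a limit of difference quotients of elements of `D(Ã)`, lies in
the closure of `D(Ã)`.
-/

namespace ShakerBeam

noncomputable section

/-! ### Primitives on an interval -/

section Interval

variable {𝕜 : Type*} [RCLike 𝕜] {a b c d : ℝ} {u f g : ℝ → 𝕜}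

theorem HasWeakDeriv.mono (hw : HasWeakDeriv a b u g) (hac : a ≤ c) (hdb : d ≤ b) :
    HasWeakDeriv c d u g := by
  intro φ h1 h2 h3
  have hsub : Ioo c d ⊆ Ioo a b := Ioo_subset_Ioo hac hdb
  have h0 : ∀ x, x ∉ Ioo c d → φ x = 0 := fun x hx =>
    image_eq_zero_of_notMem_tsupport fun hx' => hx (h3 hx')
  have h0' : ∀ x, x ∉ Ioo c d → deriv φ x = 0 := fun x hx =>
    image_eq_zero_of_notMem_tsupport fun hx' => hx (h3 (tsupport_deriv_subset hx'))
  have key := hw φ h1 h2 (h3.trans hsub)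
  rw [setIntegral_eq_integral_of_forall_compl_eq_zero
      (fun x hx => by rw [h0' x fun hx' => hx (hsub hx'), zero_smul]),
    setIntegral_eq_integral_of_forall_compl_eq_zero
      (fun x hx => by rw [h0 x fun hx' => hx (hsub hx'), zero_smul])] at key
  rw [setIntegral_eq_integral_of_forall_compl_eq_zero
      (fun x hx => by rw [h0' x hx, zero_smul]),
    setIntegral_eq_integral_of_forall_compl_eq_zero
      (fun x hx => by rw [h0 x hx, zero_smul])]
  exact key

theorem hasWeakDeriv_const (c : 𝕜) : HasWeakDeriv a b (fun _ => c) 0 := by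
  intro φ h1 h2 h3
  have h0' : ∀ x, x ∉ Ioo a b → deriv φ x • c = 0 := fun x hx => by
    rw [image_eq_zero_of_notMem_tsupport fun hx' => hx (h3 (tsupport_deriv_subset hx')), zero_smul]
  have hd : Continuous (deriv φ) := h1.continuous_deriv (by simp)
  rw [setIntegral_eq_integral_of_forall_compl_eq_zero h0', integral_smul_const,
    integral_eq_zero_of_hasDerivAt_of_integrable
      (fun x => (h1.differentiable (by simp) x).hasDerivAt)
      (hd.integrable_of_hasCompactSupport h2.deriv)
      (h1.continuous.integrable_of_hasCompactSupport h2)]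
  simp

theorem HasWeakDeriv.const_add (c : 𝕜) (hw : HasWeakDeriv a b u g)
    (hu : Integrable u (volume.restrict (Ioo a b)))
    (hg : Integrable g (volume.restrict (Ioo a b))) :
    HasWeakDeriv a b (fun x => c + u x) g := by
  have := (hasWeakDeriv_const (a := a) (b := b) c).add hw (integrable_const c) hu
    (integrable_zero _ _ _) hg
  rwa [zero_add] at this

theorem continuousOn_primitive (hg : Integrable g (volume.restrict (Ioo 0 b))) :
    ContinuousOn (fun x => ∫ t in (0 : ℝ)..x, g t) (Icc 0 b) := by
  rcases le_or_gt 0 b with hb | hb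
  · have hg' : IntegrableOn g (Icc 0 b) := by
      rw [integrableOn_Icc_iff_integrableOn_Ioo]; exact hg
    exact intervalIntegral.continuousOn_primitive_interval
      (by rw [uIcc_of_le hb]; exact hg') |>.mono (by rw [uIcc_of_le hb])
  · simp [hb]

theorem norm_primitive_le (hg : Integrable g (volume.restrict (Ioo 0 b))) {x : ℝ}
    (hx : x ∈ Icc 0 b) : ‖∫ t in (0 : ℝ)..x, g t‖ ≤ ∫ t in Ioo 0 b, ‖g t‖ := by
  rw [intervalIntegral.integral_of_le hx.1, integral_Ioc_eq_integral_Ioo]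
  exact (norm_integral_le_integral_norm _).trans
    (setIntegral_mono_set hg.norm (Eventually.of_forall fun _ => norm_nonneg _)
      (Ioo_subset_Ioo_right hx.2).eventuallyLE)

theorem memLp_of_continuousOn_Icc (hf : ContinuousOn f (Icc a b)) :
    MemLp f 2 (volume.restrict (Ioo a b)) := by
  obtain ⟨C, hC⟩ := isCompact_Icc.exists_bound_of_continuousOn hf
  exact MemLp.of_bound (C := C)
    ((hf.mono Ioo_subset_Icc_self).aestronglyMeasurable measurableSet_Ioo)
    ((ae_restrict_iff' measurableSet_Ioo).2
      (Eventually.of_forall fun x hx => hC x (Ioo_subset_Icc_self hx)))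

/-- Integration by parts for two primitives vanishing at `0`, by Fubini's theorem on the
triangle `x < t`. -/
theorem integral_primitive_mul_add (hf : Integrable f (volume.restrict (Ioo 0 b)))
    (hg : Integrable g (volume.restrict (Ioo 0 b))) :
    (∫ x in Ioo 0 b, (∫ t in (0 : ℝ)..x, f t) * g x) +
      ∫ x in Ioo 0 b, f x * ∫ t in (0 : ℝ)..x, g t =
    (∫ x in Ioo 0 b, f x) * ∫ x in Ioo 0 b, g x := by
  let F : ℝ → ℝ → 𝕜 := fun x t => {p : ℝ × ℝ | p.1 < p.2}.indicator
    (fun p => g p.1 * f p.2) (x, t)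
  have hF : Integrable (Function.uncurry F)
      ((volume.restrict (Ioo 0 b)).prod (volume.restrict (Ioo 0 b))) :=
    (hg.mul_prod hf).indicator
      (s := {p : ℝ × ℝ | p.1 < p.2}) (measurableSet_lt measurable_fst measurable_snd)
  have hsw := integral_integral_swap hF
  have e1 : ∫ x in Ioo 0 b, ∫ t in Ioo 0 b, F x t =
      ∫ x in Ioo 0 b, ((∫ t in Ioo 0 b, f t) * g x - (∫ t in (0 : ℝ)..x, f t) * g x) := by
    refine setIntegral_congr_fun measurableSet_Ioo (fun x hx => ?_)
    have : F x = (Ioi x).indicator (fun t => g x * f t) := by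
      funext t; simp [F, Set.indicator]
    have hfi : ∀ s ⊆ Ioc 0 b, IntegrableOn f s := fun s hs =>
      IntegrableOn.mono_set (by rw [integrableOn_Ioc_iff_integrableOn_Ioo]; exact hf) hs
    have hadd : (∫ t in (0 : ℝ)..x, f t) + ∫ t in x..b, f t = ∫ t in (0 : ℝ)..b, f t :=
      intervalIntegral.integral_add_adjacent_intervals
        ((intervalIntegrable_iff_integrableOn_Ioc_of_le hx.1.le).2
          (hfi _ (Ioc_subset_Ioc_right hx.2.le)))
        ((intervalIntegrable_iff_integrableOn_Ioc_of_le hx.2.le).2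
          (hfi _ (Ioc_subset_Ioc_left hx.1.le)))
    rw [intervalIntegral.integral_of_le hx.2.le,
      intervalIntegral.integral_of_le (hx.1.trans hx.2).le, integral_Ioc_eq_integral_Ioo,
      integral_Ioc_eq_integral_Ioo] at hadd
    rw [this, integral_indicator measurableSet_Ioi, Measure.restrict_restrict measurableSet_Ioi,
      show Ioi x ∩ Ioo 0 b = Ioo x b by
        ext t; simp only [mem_inter_iff, mem_Ioi, mem_Ioo]
        exact ⟨fun h => ⟨h.1, h.2.2⟩, fun h => ⟨h.1, hx.1.trans h.1, h.2⟩⟩,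
      integral_const_mul, ← hadd]
    ring
  have e2 : ∫ t in Ioo 0 b, ∫ x in Ioo 0 b, F x t =
      ∫ t in Ioo 0 b, f t * ∫ x in (0 : ℝ)..t, g x := by
    refine setIntegral_congr_fun measurableSet_Ioo (fun t ht => ?_)
    have : (fun x => F x t) = (Iio t).indicator (fun x => g x * f t) := by
      funext x; simp [F, Set.indicator]
    rw [this, integral_indicator measurableSet_Iio, Measure.restrict_restrict measurableSet_Iio,
      show Iio t ∩ Ioo 0 b = Ioo 0 t by
        ext x; simp only [mem_inter_iff, mem_Iio, mem_Ioo]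
        exact ⟨fun h => ⟨h.2.1, h.1⟩, fun h => ⟨h.2, h.1, h.2.trans ht.2⟩⟩,
      integral_mul_const, intervalIntegral.integral_of_le ht.1.le, integral_Ioc_eq_integral_Ioo,
      mul_comm]
  have hi : Integrable (fun x => (∫ t in (0 : ℝ)..x, f t) * g x) (volume.restrict (Ioo 0 b)) := by
    refine hg.bdd_mul (c := ∫ t in Ioo 0 b, ‖f t‖)
      (((continuousOn_primitive hf).mono Ioo_subset_Icc_self).aestronglyMeasurable
        measurableSet_Ioo) ?_
    exact (ae_restrict_iff' measurableSet_Ioo).2 (Eventually.of_forall fun x hx =>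
      norm_primitive_le hf (Ioo_subset_Icc_self hx))
  rw [← e2, ← hsw, e1, integral_sub (hg.const_mul _) hi, integral_const_mul]
  ring

/-- The primitive of `g` on `(0, b)` of mean value zero. -/
def meanZeroPrimitive (b : ℝ) (g : ℝ → 𝕜) (x : ℝ) : 𝕜 :=
  (∫ t in (0 : ℝ)..x, g t) - (b⁻¹ : ℝ) • ∫ x in Ioo 0 b, ∫ t in (0 : ℝ)..x, g t

/-- The solution `w` of the Dirichlet problem `w'' = g` on `(0, b)`, `w(0) = w(b) = 0`. -/
def dirichletSolution (b : ℝ) (g : ℝ → 𝕜) (x : ℝ) : 𝕜 :=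
  ∫ t in (0 : ℝ)..x, meanZeroPrimitive b g t

theorem integrable_primitive (hg : Integrable g (volume.restrict (Ioo 0 b))) :
    Integrable (fun x => ∫ t in (0 : ℝ)..x, g t) (volume.restrict (Ioo 0 b)) :=
  memLp_integrable (memLp_of_continuousOn_Icc (continuousOn_primitive hg))

theorem continuousOn_meanZeroPrimitive (hg : Integrable g (volume.restrict (Ioo 0 b))) :
    ContinuousOn (meanZeroPrimitive b g) (Icc 0 b) :=
  (continuousOn_primitive hg).sub continuousOn_const

theorem memLp_meanZeroPrimitive (hg : Integrable g (volume.restrict (Ioo 0 b))) :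
    MemLp (meanZeroPrimitive b g) 2 (volume.restrict (Ioo 0 b)) :=
  memLp_of_continuousOn_Icc (continuousOn_meanZeroPrimitive hg)

theorem integrable_meanZeroPrimitive (hg : Integrable g (volume.restrict (Ioo 0 b))) :
    Integrable (meanZeroPrimitive b g) (volume.restrict (Ioo 0 b)) :=
  memLp_integrable (memLp_meanZeroPrimitive hg)

theorem integral_meanZeroPrimitive (hb : 0 < b) (hg : Integrable g (volume.restrict (Ioo 0 b))) :
    ∫ x in Ioo 0 b, meanZeroPrimitive b g x = 0 := by
  unfold meanZeroPrimitive
  rw [integral_sub (integrable_primitive hg) (integrable_const _), integral_const, smul_smul]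
  simp [hb.le, hb.ne']

theorem norm_meanZeroPrimitive_le (hb : 0 < b) (hg : Integrable g (volume.restrict (Ioo 0 b)))
    {x : ℝ} (hx : x ∈ Icc 0 b) :
    ‖meanZeroPrimitive b g x‖ ≤ 2 * ∫ t in Ioo 0 b, ‖g t‖ := by
  have h1 : ‖∫ x in Ioo 0 b, ∫ t in (0 : ℝ)..x, g t‖ ≤
      (∫ t in Ioo 0 b, ‖g t‖) * volume.real (Ioo 0 b) :=
    norm_setIntegral_le_of_norm_le_const (by simp)
      fun x hx => norm_primitive_le hg (Ioo_subset_Icc_self hx)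
  refine (norm_sub_le _ _).trans ?_
  have h2 : ‖(b⁻¹ : ℝ) • ∫ x in Ioo 0 b, ∫ t in (0 : ℝ)..x, g t‖ ≤ ∫ t in Ioo 0 b, ‖g t‖ := by
    rw [norm_smul, Real.norm_of_nonneg (by positivity)]
    simp only [Real.volume_real_Ioo, sub_zero, max_eq_left hb.le] at h1
    calc b⁻¹ * _ ≤ b⁻¹ * ((∫ t in Ioo 0 b, ‖g t‖) * b) := by gcongr
      _ = _ := by field_simp
  linarith [norm_primitive_le hg hx]

theorem hasWeakDeriv_meanZeroPrimitive (hg : Integrable g (volume.restrict (Ioo 0 b))) :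
    HasWeakDeriv 0 b (meanZeroPrimitive b g) g := by
  have := (hasWeakDeriv_primitive hg).const_add
    (-((b⁻¹ : ℝ) • ∫ x in Ioo 0 b, ∫ t in (0 : ℝ)..x, g t)) (integrable_primitive hg) hg
  refine this.congr (Eventually.of_forall fun x => ?_) (ae_eq_refl _)
  simp only [meanZeroPrimitive]; ring

theorem continuousOn_dirichletSolution (hg : Integrable g (volume.restrict (Ioo 0 b))) :
    ContinuousOn (dirichletSolution b g) (Icc 0 b) :=
  continuousOn_primitive (integrable_meanZeroPrimitive hg)

theorem hasWeakDeriv_dirichletSolution (hg : Integrable g (volume.restrict (Ioo 0 b))) :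
    HasWeakDeriv 0 b (dirichletSolution b g) (meanZeroPrimitive b g) :=
  hasWeakDeriv_primitive (integrable_meanZeroPrimitive hg)

theorem dirichletSolution_left : dirichletSolution b g 0 = 0 := intervalIntegral.integral_same

theorem dirichletSolution_right (hb : 0 < b) (hg : Integrable g (volume.restrict (Ioo 0 b))) :
    dirichletSolution b g b = 0 := by
  rw [dirichletSolution, intervalIntegral.integral_of_le hb.le, integral_Ioc_eq_integral_Ioo,
    integral_meanZeroPrimitive hb hg]

theorem intervalIntegrable_meanZeroPrimitive (hg : Integrable g (volume.restrict (Ioo 0 b)))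
    {x y : ℝ} (hx : x ∈ Icc 0 b) (hy : y ∈ Icc 0 b) :
    IntervalIntegrable (meanZeroPrimitive b g) volume x y :=
  ((continuousOn_meanZeroPrimitive hg).mono (uIcc_subset_Icc hx hy)).intervalIntegrable

/-- The Dirichlet solution is Lipschitz, with a constant controlled by the `L¹` norm of the
right-hand side: the source of compactness. -/
theorem norm_dirichletSolution_sub_le (hb : 0 < b)
    (hg : Integrable g (volume.restrict (Ioo 0 b))) {x y : ℝ} (hx : x ∈ Icc 0 b)
    (hy : y ∈ Icc 0 b) :
    ‖dirichletSolution b g x - dirichletSolution b g y‖ ≤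
      (2 * ∫ t in Ioo 0 b, ‖g t‖) * |x - y| := by
  have h0 : (0 : ℝ) ∈ Icc 0 b := left_mem_Icc.2 hb.le
  unfold dirichletSolution
  rw [intervalIntegral.integral_interval_sub_left (intervalIntegrable_meanZeroPrimitive hg h0 hx)
    (intervalIntegrable_meanZeroPrimitive hg h0 hy)]
  refine intervalIntegral.norm_integral_le_of_norm_le_const fun t ht => ?_
  exact norm_meanZeroPrimitive_le hb hg (uIcc_subset_Icc hy hx (uIoc_subset_uIcc ht))

/-- Integration by parts against a primitive with vanishing boundary values; the mean-free
primitive of `g` may be used since `f` has mean value zero. -/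
theorem integral_inner_primitive (hf : Integrable f (volume.restrict (Ioo 0 b)))
    (hf0 : ∫ x in Ioo 0 b, f x = 0) (hg : Integrable g (volume.restrict (Ioo 0 b))) :
    ∫ x in Ioo 0 b, inner 𝕜 (∫ t in (0 : ℝ)..x, f t) (g x) =
      -∫ x in Ioo 0 b, inner 𝕜 (f x) (meanZeroPrimitive b g x) := by
  have hfc : Integrable (fun x => (starRingEnd 𝕜) (f x)) (volume.restrict (Ioo 0 b)) :=
    RCLike.conjCLE.toContinuousLinearMap.integrable_comp hf
  have hfc0 : ∫ x in Ioo 0 b, (starRingEnd 𝕜) (f x) = 0 := by rw [integral_conj, hf0, map_zero]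
  have key := integral_primitive_mul_add hfc hg
  rw [hfc0, zero_mul] at key
  have e1 : ∀ x, inner 𝕜 (∫ t in (0 : ℝ)..x, f t) (g x) =
      (∫ t in (0 : ℝ)..x, (starRingEnd 𝕜) (f t)) * g x := fun x => by
    rw [RCLike.inner_apply', intervalIntegral.intervalIntegral_eq_integral_uIoc,
      intervalIntegral.intervalIntegral_eq_integral_uIoc, integral_conj]
    split_ifs <;> simp
  have hi : Integrable (fun x => (starRingEnd 𝕜) (f x) * ∫ t in (0 : ℝ)..x, g t)
      (volume.restrict (Ioo 0 b)) := by
    refine hfc.mul_bdd (c := ∫ t in Ioo 0 b, ‖g t‖)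
      (((continuousOn_primitive hg).mono Ioo_subset_Icc_self).aestronglyMeasurable
        measurableSet_Ioo) ?_
    exact (ae_restrict_iff' measurableSet_Ioo).2 (Eventually.of_forall fun x hx =>
      norm_primitive_le hg (Ioo_subset_Icc_self hx))
  have e2 : ∫ x in Ioo 0 b, inner 𝕜 (f x) (meanZeroPrimitive b g x) =
      ∫ x in Ioo 0 b, (starRingEnd 𝕜) (f x) * ∫ t in (0 : ℝ)..x, g t := by
    simp only [RCLike.inner_apply', meanZeroPrimitive, mul_sub]
    rw [integral_sub hi (hfc.mul_const _), integral_mul_const, hfc0, zero_mul, sub_zero]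
  simp only [e1]
  rw [e2, eq_neg_iff_add_eq_zero, key]

/-- The iterated `weakDeriv`, a choice among a.e. equal functions, is identified by any chain of
square-integrable weak derivatives. -/
theorem iterate_weakDeriv_of_chain {f : ℕ → ℝ → 𝕜} {n : ℕ}
    (hL : ∀ i ≤ n, MemLp (f i) 2 (volume.restrict (Ioo a b)))
    (hw : ∀ i < n, HasWeakDeriv a b (f i) (f (i + 1))) :
    MemSobolev a b n (f 0) ∧
      (weakDeriv a b)^[n] (f 0) =ᵐ[volume.restrict (Ioo a b)] f n := by
  have hS : ∀ k i, i + k = n → MemSobolev a b k (f i) := by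
    intro k
    induction k with
    | zero => intro i hi; exact hL i (by omega)
    | succ k ih =>
      intro i hi
      exact ⟨hL i (by omega), f (i + 1), hw i (by omega), ih (i + 1) (by omega)⟩
  refine ⟨hS n 0 (by omega), ?_⟩
  have hI : ∀ i ≤ n, (weakDeriv a b)^[i] (f 0) =ᵐ[volume.restrict (Ioo a b)] f i := by
    intro i
    induction i with
    | zero => intro _; rfl
    | succ i ih =>
      intro hi
      rw [Function.iterate_succ_apply', weakDeriv_congr (ih (by omega))]
      have hs := MemSobolev.weakDeriv_spec
        ((hS (n - i) i (by omega)).mono (m := 0 + 1) (by omega))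
      exact hs.1.unique (hw i (by omega)) (memLp_integrable hs.2.memLp)
        (memLp_integrable (hL _ hi))
  exact hI n le_rfl

/-- A function in `H⁴(a, b)` with vanishing fourth derivative has an affine second derivative,
whose slope is the constant third derivative. -/
theorem exists_affine_of_fourth_deriv_eq_zero {a b : ℝ} (hab : a < b) {u : ℝ → 𝕜}
    (hu : MemSobolev a b 4 u) (h4 : (weakDeriv a b)^[4] u =ᵐ[volume.restrict (Ioo a b)] 0) :
    ∃ r s : 𝕜,
      (weakDeriv a b)^[2] u =ᵐ[volume.restrict (Ioo a b)] (fun x => r + ((x - a : ℝ) : 𝕜) * s) ∧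
      (∀ x ∈ Icc a b, pointValue a b ((weakDeriv a b)^[2] u) x = r + ((x - a : ℝ) : 𝕜) * s) ∧
      ∀ x ∈ Icc a b, pointValue a b ((weakDeriv a b)^[3] u) x = s := by
  have h2 : MemSobolev a b 2 ((weakDeriv a b)^[2] u) := MemSobolev.iterate hu
  have s2 := h2.weakDeriv_spec
  have s3 := s2.2.weakDeriv_spec
  simp only [← Function.iterate_succ_apply' (weakDeriv a b)] at s2 s3
  obtain ⟨s, hs⟩ := ae_eq_const_of_hasWeakDeriv_zero hab (memLp_integrable s2.2.memLp)
    (s3.1.congr (ae_eq_refl _) h4)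
  obtain ⟨-, r, hr⟩ := (s2.1.congr (ae_eq_refl _) hs).ae_eq_primitive hab
    (memLp_integrable h2.memLp) (integrable_const s)
  simp only [intervalIntegral.integral_const, RCLike.real_smul_eq_coe_mul] at hr
  refine ⟨r, s, hr, fun x hx => pointValue_eq hab (Continuous.continuousOn ?_) hr hx,
    fun x hx => pointValue_eq hab continuousOn_const hs hx⟩
  exact continuous_const.add ((RCLike.continuous_ofReal.comp (by fun_prop)).mul continuous_const)

theorem iterate_weakDeriv_mono {a b c d : ℝ} (hac : a ≤ c) (hdb : d ≤ b) {u : ℝ → 𝕜} {n : ℕ}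
    (hu : MemSobolev a b n u) :
    (weakDeriv c d)^[n] u =ᵐ[volume.restrict (Ioo c d)] (weakDeriv a b)^[n] u := by
  have hm : volume.restrict (Ioo c d) ≤ volume.restrict (Ioo a b) :=
    Measure.restrict_mono (Ioo_subset_Ioo hac hdb) le_rfl
  refine (iterate_weakDeriv_of_chain (f := fun i => (weakDeriv a b)^[i] u) (fun i hi => ?_)
    (fun i hi => ?_)).2
  · exact (MemSobolev.iterate (n := 0) (hu.mono (by omega))).memLp.mono_measure hm
  · have := (MemSobolev.iterate (n := 1) (i := i) (hu.mono (by omega))).weakDeriv_spec.1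
    rw [← Function.iterate_succ_apply' (weakDeriv a b)] at this
    exact this.mono hac hdb

end Interval

/-! ### Dissipative operators with compact resolvent -/

section Compact

variable {𝕜 : Type*} [RCLike 𝕜]

theorem isCompactOperator_prod {E F G : Type*} [TopologicalSpace E] [Zero E] [TopologicalSpace F]
    [TopologicalSpace G] {f : E → F} {g : E → G} (hf : IsCompactOperator f)
    (hg : IsCompactOperator g) : IsCompactOperator fun x => (f x, g x) := by
  obtain ⟨K, hK, hKf⟩ := hf
  obtain ⟨L, hL, hLg⟩ := hg
  exact ⟨K ×ˢ L, hK.prod hL, by filter_upwards [hKf, hLg] with x h1 h2 using ⟨h1, h2⟩⟩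

theorem isCompactOperator_functional {E : Type*} [NormedAddCommGroup E] [NormedSpace 𝕜 E]
    (f : E →L[𝕜] 𝕜) : IsCompactOperator f :=
  isCompactOperator_of_locallyCompactSpace_dom f

end Compact

section Dissipative

variable {𝕜 E : Type*} [RCLike 𝕜] [NormedAddCommGroup E] [InnerProductSpace 𝕜 E]

/-- `A` is dissipative: `Re ⟨x, A x⟩ ≤ 0` on the domain. -/
def IsDissipative (A : E →ₗ.[𝕜] E) : Prop :=
  ∀ x : A.domain, RCLike.re (inner 𝕜 (x : E) (A x)) ≤ 0

/-- The bounded operator `J` maps the subspace `Y` into the domain of `A` and is there a right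
inverse of `I - μ A`. -/
def IsResolventOn (A : E →ₗ.[𝕜] E) (Y : Submodule 𝕜 E) (μ : ℝ) (J : E →L[𝕜] E) : Prop :=
  ∀ y ∈ Y, ∃ h : J y ∈ A.domain, J y - (μ : 𝕜) • A ⟨J y, h⟩ = y

variable {A : E →ₗ.[𝕜] E} {Y : Submodule 𝕜 E} {J K : E →L[𝕜] E} {μ : ℝ}

theorem IsDissipative.norm_le (hA : IsDissipative A) (hμ : 0 ≤ μ) (x : A.domain) :
    ‖(x : E)‖ ≤ ‖(x : E) - (μ : 𝕜) • A x‖ := by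
  have h1 : RCLike.re (inner 𝕜 (x : E) ((x : E) - (μ : 𝕜) • A x)) =
      ‖(x : E)‖ ^ 2 - μ * RCLike.re (inner 𝕜 (x : E) (A x)) := by
    rw [inner_sub_right, inner_smul_right, map_sub, RCLike.re_ofReal_mul, inner_self_eq_norm_sq]
  have h2 := re_inner_le_norm (𝕜 := 𝕜) (x : E) ((x : E) - (μ : 𝕜) • A x)
  have h3 := mul_nonpos_of_nonneg_of_nonpos hμ (hA x)
  rcases (norm_nonneg (x : E)).eq_or_lt with h0 | h0
  · rw [← h0]; exact norm_nonneg _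
  · refine le_of_mul_le_mul_left ?_ h0
    nlinarith

theorem IsDissipative.eq_of_sub_smul_eq (hA : IsDissipative A) (hμ : 0 ≤ μ) {x y : A.domain}
    (h : (x : E) - (μ : 𝕜) • A x = y - (μ : 𝕜) • A y) : x = y := by
  have h1 := hA.norm_le hμ (x - y)
  rw [A.map_sub, Submodule.coe_sub, smul_sub, sub_sub_sub_comm, h, sub_self, norm_zero] at h1
  exact Subtype.ext (sub_eq_zero.1 (norm_le_zero_iff.1 h1))

/-- If a dissipative operator has a compact right inverse on an invariant space `Y`, then all its
resolvents exist on `Y` and are compact, by the Fredholm alternative. -/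
theorem IsDissipative.exists_isResolventOn [CompleteSpace E] (hA : IsDissipative A)
    (hK : IsCompactOperator K) (hKA : ∀ y, K y ∈ A.domain) (hAY : A.domain ≤ Y)
    (hAK : ∀ y ∈ Y, A ⟨K y, hKA y⟩ = y) (hμ : 0 < μ) :
    ∃ J : E →L[𝕜] E, IsCompactOperator J ∧ IsResolventOn A Y μ J := by
  have hμ' : (μ : 𝕜) ≠ 0 := RCLike.ofReal_ne_zero.2 hμ.ne'
  -- an eigenvector of `K` for `μ` lies in the kernel of `I - μ A`
  have hne : ¬ Module.End.HasEigenvalue (K : Module.End 𝕜 E) (μ : 𝕜) := by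
    intro h
    obtain ⟨x, hx⟩ := h.exists_hasEigenvector
    have hx1 : K x = (μ : 𝕜) • x := hx.apply_eq_smul
    have hxD : x ∈ A.domain := by
      have := A.domain.smul_mem (μ : 𝕜)⁻¹ (hKA x)
      rwa [hx1, smul_smul, inv_mul_cancel₀ hμ', one_smul] at this
    have hx2 : (⟨K x, hKA x⟩ : A.domain) = (μ : 𝕜) • ⟨x, hxD⟩ := Subtype.ext hx1
    have hx3 := hAK x (hAY hxD)
    rw [hx2, A.map_smul] at hx3
    have hx4 := hA.norm_le hμ.le ⟨x, hxD⟩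
    rw [hx3, sub_self, norm_zero] at hx4
    exact hx.2 (norm_le_zero_iff.1 hx4)
  have hres := (hK.hasEigenvalue_or_mem_resolventSet hμ').resolve_left hne
  rw [spectrum.mem_resolventSet_iff] at hres
  obtain ⟨U, hU⟩ := hres
  let R : E →L[𝕜] E := ↑U⁻¹
  have hR : ∀ y, (μ : 𝕜) • R y - K (R y) = y := fun y => by
    have : (U : E →L[𝕜] E) * R = 1 := U.mul_inv
    rw [hU] at this
    have := congrArg (fun T : E →L[𝕜] E => T y) this
    simpa [Algebra.algebraMap_eq_smul_one] using this
  refine ⟨-(K ∘L R), (hK.comp_clm R).neg, fun y hy => ?_⟩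
  have hRy : R y ∈ Y := by
    have h1 : R y = (μ : 𝕜)⁻¹ • (y + K (R y)) := by
      nth_rewrite 2 [← hR y]
      rw [sub_add_cancel, smul_smul, inv_mul_cancel₀ hμ', one_smul]
    rw [h1]
    exact Y.smul_mem _ (Y.add_mem hy (hAY (hKA _)))
  have e : ∀ h, A ⟨(-(K ∘L R)) y, h⟩ = -R y := fun h => by
    rw [← hAK _ hRy, ← A.map_neg]; rfl
  refine ⟨A.domain.neg_mem (hKA _), ?_⟩
  rw [e, smul_neg, sub_neg_eq_add]
  exact (neg_add_eq_sub _ _).trans (hR y)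

theorem IsResolventOn.apply_sub_smul (hJ : IsResolventOn A Y μ J) (hA : IsDissipative A)
    (hμ : 0 ≤ μ) (hAY : A.domain ≤ Y) (hran : ∀ x : A.domain, A x ∈ Y) (x : A.domain) :
    J ((x : E) - (μ : 𝕜) • A x) = x := by
  obtain ⟨h, e⟩ := hJ ((x : E) - (μ : 𝕜) • A x)
    (Y.sub_mem (hAY x.2) (Y.smul_mem _ (hran x)))
  exact congrArg Subtype.val (hA.eq_of_sub_smul_eq (x := ⟨_, h⟩) hμ e)

theorem IsResolventOn.norm_le (hJ : IsResolventOn A Y μ J) (hA : IsDissipative A) (hμ : 0 ≤ μ)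
    {y : E} (hy : y ∈ Y) : ‖J y‖ ≤ ‖y‖ := by
  obtain ⟨h, e⟩ := hJ y hy
  have := hA.norm_le hμ ⟨J y, h⟩
  rwa [e] at this

theorem IsResolventOn.apply_generator (hJ : IsResolventOn A Y μ J) (hA : IsDissipative A)
    (hμ : 0 < μ) (hAY : A.domain ≤ Y) (hran : ∀ x : A.domain, A x ∈ Y) (x : A.domain) :
    J (A x) = (μ : 𝕜)⁻¹ • (J x - x) := by
  have hμ' : (μ : 𝕜) ≠ 0 := RCLike.ofReal_ne_zero.2 hμ.ne'
  have := hJ.apply_sub_smul hA hμ.le hAY hran x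
  rw [map_sub, map_smul, sub_eq_iff_eq_add, add_comm, ← sub_eq_iff_eq_add] at this
  rw [this, smul_smul, inv_mul_cancel₀ hμ', one_smul]

theorem IsResolventOn.generator_apply (hJ : IsResolventOn A Y μ J) (hμ : 0 < μ) {y : E}
    (hy : y ∈ Y) (h : J y ∈ A.domain) : A ⟨J y, h⟩ = (μ : 𝕜)⁻¹ • (J y - y) := by
  have hμ' : (μ : 𝕜) ≠ 0 := RCLike.ofReal_ne_zero.2 hμ.ne'
  obtain ⟨_, e⟩ := hJ y hy
  rw [sub_eq_iff_eq_add, add_comm, ← sub_eq_iff_eq_add] at e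
  rw [e, smul_smul, inv_mul_cancel₀ hμ', one_smul]

/-- The resolvents approximate the identity on the closure of the domain. -/
theorem IsDissipative.exists_norm_resolvent_sub_le (hA : IsDissipative A) (hAY : A.domain ≤ Y)
    (hran : ∀ x : A.domain, A x ∈ Y) (hY : IsClosed (Y : Set E)) {x : E}
    (hx : x ∈ closure (A.domain : Set E)) {ε : ℝ} (hε : 0 < ε) :
    ∃ μ : ℝ, 0 < μ ∧ ∀ J : E →L[𝕜] E, IsResolventOn A Y μ J → ‖x - J x‖ ≤ ε := by
  have hxY : x ∈ Y := closure_minimal hAY hY hx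
  obtain ⟨x', hx', hd⟩ := Metric.mem_closure_iff.1 hx (ε / 3) (by positivity)
  rw [dist_eq_norm] at hd
  set c := ‖A ⟨x', hx'⟩‖
  have hc : 0 ≤ c := norm_nonneg _
  refine ⟨ε / (3 * (c + 1)), by positivity, fun J hJ => ?_⟩
  set μ := ε / (3 * (c + 1))
  have hμ : 0 < μ := by positivity
  have h1 : ‖x' - J x'‖ ≤ ε / 3 := by
    have h2 := hJ.apply_sub_smul hA hμ.le hAY hran ⟨x', hx'⟩
    rw [map_sub, map_smul] at h2
    have h3 : x' - J x' = -((μ : 𝕜) • J (A ⟨x', hx'⟩)) := by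
      rw [sub_eq_iff_eq_add] at h2
      rw [h2]
      simp
    rw [h3, norm_neg, norm_smul, RCLike.norm_ofReal, abs_of_pos hμ]
    calc μ * ‖J (A ⟨x', hx'⟩)‖ ≤ μ * (c + 1) := by
          gcongr
          exact (hJ.norm_le hA hμ.le (hran _)).trans (by linarith)
      _ = ε / 3 := by simp only [μ]; field_simp
  have h4 : ‖J (x - x')‖ ≤ ‖x - x'‖ := hJ.norm_le hA hμ.le (Y.sub_mem hxY (hAY hx'))
  have h5 : x - J x = (x - x') + (x' - J x') - J (x - x') := by rw [map_sub]; abel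
  rw [h5]
  linarith [norm_sub_le ((x - x') + (x' - J x')) (J (x - x')), norm_add_le (x - x') (x' - J x')]

/-- `ξ` is a mild solution of `ξ' = A ξ` on `[0, ∞)` whose primitive is `η`, up to a constant. -/
structure IsMildSolution (A : E →ₗ.[𝕜] E) (ξ η : ℝ → E) : Prop where
  continuousOn : ContinuousOn ξ (Ici 0)
  tendsto : ∀ t, 0 ≤ t → Tendsto (fun s : ℝ => (((s - t)⁻¹ : ℝ) : 𝕜) • (η s - η t))
    (𝓝[Ici 0 \ {t}] t) (𝓝 (ξ t))
  eq_add : ∀ t, 0 ≤ t → ∃ h : η t ∈ A.domain, ξ t = ξ 0 + A ⟨η t, h⟩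

variable {ξ η : ℝ → E}

theorem IsMildSolution.mem_closure (h : IsMildSolution A ξ η) {t : ℝ} (ht : 0 ≤ t) :
    ξ t ∈ closure (A.domain : Set E) := by
  have : (𝓝[Ici 0 \ {t}] t).NeBot :=
    NeBot.mono (nhdsGT_neBot t)
      (nhdsWithin_mono _ fun s hs => ⟨ht.trans (le_of_lt hs), ne_of_gt hs⟩)
  refine mem_closure_of_tendsto (h.tendsto t ht) ?_
  filter_upwards [self_mem_nhdsWithin] with s hs
  obtain ⟨h1, -⟩ := h.eq_add t ht
  obtain ⟨h2, -⟩ := h.eq_add s hs.1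
  exact A.domain.smul_mem _ (A.domain.sub_mem h2 h1)

/-- A resolvent turns a mild solution into a classical one, along which the norm decreases. -/
theorem IsMildSolution.norm_resolvent_le (h : IsMildSolution A ξ η) (hA : IsDissipative A)
    (hAY : A.domain ≤ Y) (hran : ∀ x : A.domain, A x ∈ Y) (hY : IsClosed (Y : Set E))
    (hμ : 0 < μ) (hJ : IsResolventOn A Y μ J) {t : ℝ} (ht : 0 ≤ t) : ‖J (ξ t)‖ ≤ ‖J (ξ 0)‖ := by
  let : InnerProductSpace ℝ E := InnerProductSpace.rclikeToReal 𝕜 E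
  have hξY : ∀ s, 0 ≤ s → ξ s ∈ Y := fun s hs => closure_minimal hAY hY (h.mem_closure hs)
  have hη : ∀ s, 0 ≤ s → HasDerivWithinAt η (ξ s) (Ici 0) s := fun s hs => by
    rw [hasDerivWithinAt_iff_tendsto_slope]
    exact h.tendsto s hs
  let L : E →L[𝕜] E := (μ : 𝕜)⁻¹ • (J - ContinuousLinearMap.id 𝕜 E)
  have hζ : ∀ s, 0 ≤ s → J (ξ s) = J (ξ 0) + L (η s) := fun s hs => by
    obtain ⟨hm, e⟩ := h.eq_add s hs
    rw [e, map_add, hJ.apply_generator hA hμ hAY hran]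
    rfl
  have hLξ : ∀ s, 0 ≤ s → ∃ hm : J (ξ s) ∈ A.domain, A ⟨J (ξ s), hm⟩ = L (ξ s) := fun s hs => by
    obtain ⟨hm, -⟩ := hJ _ (hξY s hs)
    exact ⟨hm, hJ.generator_apply hμ (hξY s hs) hm⟩
  have hd : ∀ s, 0 < s → HasDerivAt (fun s => J (ξ 0) + L (η s)) (L (ξ s)) s := fun s hs => by
    have h1 : HasDerivAt η (ξ s) s := (hη s hs.le).hasDerivAt (Ici_mem_nhds hs)
    have h2 : HasDerivAt (fun s => L (η s)) (L (ξ s)) s := by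
      have := ((L.restrictScalars ℝ).hasFDerivAt (x := η s)).comp_hasDerivAt s h1
      exact this
    exact h2.const_add _
  have hanti : AntitoneOn (fun s => ‖J (ξ s)‖ ^ 2) (Ici 0) := by
    refine antitoneOn_of_hasDerivWithinAt_nonpos (convex_Ici 0)
      (f' := fun s => 2 * inner ℝ (J (ξ s)) (L (ξ s))) ?_ ?_ ?_
    · exact ((J.continuous.comp_continuousOn h.continuousOn).norm.pow 2)
    · intro s hs
      rw [interior_Ici] at hs ⊢
      have h1 := (hd s hs).norm_sq.hasDerivWithinAt (s := Ioi 0)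
      rw [← hζ s (le_of_lt hs)] at h1
      exact h1.congr (fun r hr => by rw [hζ r (le_of_lt hr)]) (by rw [hζ s (le_of_lt hs)])
    · intro s hs
      rw [interior_Ici] at hs
      obtain ⟨hm, e⟩ := hLξ s (le_of_lt hs)
      have h1 := hA ⟨J (ξ s), hm⟩
      rw [e] at h1
      have h2 : inner ℝ (J (ξ s)) (L (ξ s)) = RCLike.re (inner 𝕜 (J (ξ s)) (L (ξ s))) := rfl
      rw [h2]
      simp only at h1
      linarith
  exact (pow_le_pow_iff_left₀ (norm_nonneg _) (norm_nonneg _) two_ne_zero).1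
    (hanti self_mem_Ici ht ht)

/-- Mild solutions of a maximal dissipative equation are contractive. -/
theorem IsMildSolution.norm_le (h : IsMildSolution A ξ η) (hA : IsDissipative A)
    (hAY : A.domain ≤ Y) (hran : ∀ x : A.domain, A x ∈ Y) (hY : IsClosed (Y : Set E))
    (hJ : ∀ μ : ℝ, 0 < μ → ∃ J : E →L[𝕜] E, IsResolventOn A Y μ J) {t : ℝ} (ht : 0 ≤ t) :
    ‖ξ t‖ ≤ ‖ξ 0‖ := by
  refine le_of_forall_pos_le_add fun ε hε => ?_
  obtain ⟨μ, hμ, hJx⟩ := hA.exists_norm_resolvent_sub_le hAY hran hY (h.mem_closure ht) hε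
  obtain ⟨J, hJμ⟩ := hJ μ hμ
  have h1 := h.norm_resolvent_le hA hAY hran hY hμ hJμ ht
  have h2 := hJμ.norm_le hA hμ.le (closure_minimal hAY hY (h.mem_closure le_rfl))
  have h3 := hJx J hJμ
  have h4 := norm_add_le (ξ t - J (ξ t)) (J (ξ t))
  rw [sub_add_cancel] at h4
  linarith

theorem IsMildSolution.sub_resolvent (h : IsMildSolution A ξ η) (hA : IsDissipative A)
    (hAY : A.domain ≤ Y) (hran : ∀ x : A.domain, A x ∈ Y) (hμ : 0 < μ)
    (hJ : IsResolventOn A Y μ J) :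
    IsMildSolution A (fun t => ξ t - J (ξ t)) (fun t => η t - J (η t)) where
  continuousOn := h.continuousOn.sub (J.continuous.comp_continuousOn h.continuousOn)
  tendsto t ht := by
    have h1 := h.tendsto t ht
    refine (h1.sub ((J.continuous.tendsto _).comp h1)).congr fun s => ?_
    simp only [Function.comp_apply, map_smul, map_sub, smul_sub]
    abel
  eq_add t ht := by
    obtain ⟨hm, e⟩ := h.eq_add t ht
    obtain ⟨hm', -⟩ := hJ _ (hAY hm)
    refine ⟨A.domain.sub_mem hm hm', ?_⟩
    have e1 : A ⟨η t - J (η t), A.domain.sub_mem hm hm'⟩ = A ⟨η t, hm⟩ - A ⟨J (η t), hm'⟩ := by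
      rw [← A.map_sub]; rfl
    rw [e1, hJ.generator_apply hμ (hAY hm) hm', ← hJ.apply_generator hA hμ hAY hran ⟨η t, hm⟩, e,
      map_add]
    abel

/-- Trajectories of a dissipative evolution equation with compact resolvent are precompact:
uniformly in time, `ξ` is approximated by `J ξ`, which stays in the image of a ball under the
compact operator `J`. -/
theorem IsMildSolution.isCompact_closure [CompleteSpace E] (h : IsMildSolution A ξ η)
    (hA : IsDissipative A) (hAY : A.domain ≤ Y) (hran : ∀ x : A.domain, A x ∈ Y)
    (hY : IsClosed (Y : Set E))
    (hJ : ∀ μ : ℝ, 0 < μ → ∃ J : E →L[𝕜] E, IsCompactOperator J ∧ IsResolventOn A Y μ J) :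
    IsCompact (closure (ξ '' Ici 0)) := by
  have hJ' : ∀ μ : ℝ, 0 < μ → ∃ J : E →L[𝕜] E, IsResolventOn A Y μ J :=
    fun μ hμ => (hJ μ hμ).imp fun _ h => h.2
  refine (TotallyBounded.closure (Metric.totallyBounded_iff.2 fun ε hε => ?_)).isCompact_of_isClosed
    isClosed_closure
  obtain ⟨μ, hμ, hJx⟩ :=
    hA.exists_norm_resolvent_sub_le hAY hran hY (h.mem_closure le_rfl) (half_pos (half_pos hε))
  obtain ⟨J, hJc, hJμ⟩ := hJ μ hμ
  obtain ⟨C, hC, hCJ⟩ := IsCompactOperator.image_closedBall_subset_compact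
    (f := (J : E →ₗ[𝕜] E)) hJc ‖ξ 0‖
  obtain ⟨F, hF, hCF⟩ := Metric.totallyBounded_iff.1 hC.totallyBounded (ε / 2) (half_pos hε)
  refine ⟨F, hF, ?_⟩
  rintro _ ⟨t, ht, rfl⟩
  have h1 : J (ξ t) ∈ C :=
    hCJ ⟨ξ t, mem_closedBall_zero_iff.2 (h.norm_le hA hAY hran hY hJ' ht), rfl⟩
  have h2 : ‖ξ t - J (ξ t)‖ ≤ ε / 2 / 2 :=
    ((h.sub_resolvent hA hAY hran hμ hJμ).norm_le hA hAY hran hY hJ' ht).trans (hJx J hJμ)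
  obtain ⟨y, hy, hyJ⟩ := mem_iUnion₂.1 (hCF h1)
  refine mem_iUnion₂.2 ⟨y, hy, ?_⟩
  rw [Metric.mem_ball] at hyJ ⊢
  rw [← dist_eq_norm] at h2
  have h3 := dist_triangle (ξ t) (J (ξ t)) y
  linarith

end Dissipative

namespace BeamSystem

/-! ### The Dirichlet problem in `L²` and the hat function -/

section Green

variable {𝕜 : Type*} [RCLike 𝕜] (P : BeamSystem)

variable {P} in
theorem integrable_L2 (g : P.L2 𝕜) : Integrable g (volume.restrict (Ioo 0 P.l)) :=
  memLp_integrable (Lp.memLp g)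

variable {P} in
theorem memSobolev_dirichletSolution {g : ℝ → 𝕜}
    (hg : MemLp g 2 (volume.restrict (Ioo 0 P.l))) :
    MemSobolev 0 P.l 2 (dirichletSolution P.l g) ∧
      (weakDeriv 0 P.l)^[2] (dirichletSolution P.l g) =ᵐ[volume.restrict (Ioo 0 P.l)] g := by
  have hi := memLp_integrable hg
  refine iterate_weakDeriv_of_chain (n := 2) (f := fun i => match i with
    | 0 => dirichletSolution P.l g
    | 1 => meanZeroPrimitive P.l g
    | _ => g) ?_ ?_
  · intro j hj
    interval_cases j
    · exact memLp_of_continuousOn_Icc (continuousOn_dirichletSolution hi)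
    · exact memLp_meanZeroPrimitive hi
    · exact hg
  · intro j hj
    interval_cases j
    · exact hasWeakDeriv_dirichletSolution hi
    · exact hasWeakDeriv_meanZeroPrimitive hi

theorem exists_secondDeriv_eq (g : P.L2 𝕜) :
    ∃ u : P.H2₀ 𝕜, P.secondDeriv u = g ∧
      ((u : P.L2 𝕜) : ℝ → 𝕜) =ᵐ[volume.restrict (Ioo 0 P.l)] dirichletSolution P.l g := by
  obtain ⟨hS, h2⟩ := memSobolev_dirichletSolution (Lp.memLp g)
  have hc := continuousOn_dirichletSolution (integrable_L2 g)
  have hae := MemLp.coeFn_toLp hS.memLp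
  refine ⟨⟨MemLp.toLp _ hS.memLp, hS.congr hae.symm, ?_, ?_⟩, ?_, hae⟩
  · rw [pointValue_eq P.l_pos hc hae (left_mem_Icc.2 P.l_pos.le), dirichletSolution_left]
  · rw [pointValue_eq P.l_pos hc hae (right_mem_Icc.2 P.l_pos.le),
      dirichletSolution_right P.l_pos (integrable_L2 g)]
  · exact Lp.ext ((MemLp.coeFn_toLp (MemSobolev.iterate (n := 0) (i := 2)
      (hS.congr hae.symm)).memLp).trans ((iterate_weakDeriv_congr hae).trans h2))

/-- The second derivative `u ↦ u''` as a linear isomorphism of `H̊²(0, l)` onto `L²(0, l)`. -/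
def secondDerivEquiv (𝕜 : Type*) [RCLike 𝕜] : P.H2₀ 𝕜 ≃ₗ[𝕜] P.L2 𝕜 :=
  LinearEquiv.ofBijective P.secondDeriv
    ⟨(injective_iff_map_eq_zero _).2 fun _ => P.secondDeriv_eq_zero,
      fun g => (P.exists_secondDeriv_eq g).imp fun _ h => h.1⟩

/-- The solution operator of the Dirichlet problem `u'' = g`, `u(0) = u(l) = 0`. -/
def dirichlet (𝕜 : Type*) [RCLike 𝕜] : P.L2 𝕜 →ₗ[𝕜] P.H2₀ 𝕜 :=
  (P.secondDerivEquiv 𝕜).symm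

@[simp] theorem secondDeriv_dirichlet (g : P.L2 𝕜) : P.secondDeriv (P.dirichlet 𝕜 g) = g :=
  (P.secondDerivEquiv 𝕜).apply_symm_apply g

@[simp] theorem dirichlet_secondDeriv (u : P.H2₀ 𝕜) : P.dirichlet 𝕜 (P.secondDeriv u) = u :=
  (P.secondDerivEquiv 𝕜).symm_apply_apply u

theorem coeFn_dirichlet (g : P.L2 𝕜) :
    ((P.dirichlet 𝕜 g : P.L2 𝕜) : ℝ → 𝕜) =ᵐ[volume.restrict (Ioo 0 P.l)]
      dirichletSolution P.l g := by
  obtain ⟨u, hu, hae⟩ := P.exists_secondDeriv_eq g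
  rw [← hu, dirichlet_secondDeriv, hu]
  exact hae

theorem evalL₀_dirichlet_eq (g : P.L2 𝕜) :
    P.evalL₀ (P.dirichlet 𝕜 g) = dirichletSolution P.l g P.l₀ :=
  pointValue_eq P.l_pos (continuousOn_dirichletSolution (integrable_L2 g)) (P.coeFn_dirichlet g)
    P.l₀_mem

/-- For a primitive `F` of a function `f` of mean value zero,
`∫ F̄ g = -∫ f̄ w'` with `w` the Dirichlet solution of `w'' = g`. -/
theorem inner_primitive_eq {f : ℝ → 𝕜} (hf : Integrable f (volume.restrict (Ioo 0 P.l)))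
    (hf0 : ∫ x in Ioo 0 P.l, f x = 0) {F : P.L2 𝕜}
    (hF : F =ᵐ[volume.restrict (Ioo 0 P.l)] fun x => ∫ t in (0 : ℝ)..x, f t) (g : P.L2 𝕜) :
    inner 𝕜 F g = -∫ x in Ioo 0 P.l, inner 𝕜 (f x) (meanZeroPrimitive P.l g x) := by
  rw [← integral_inner_primitive hf hf0 (integrable_L2 g), L2.inner_def]
  refine integral_congr_ae ?_
  filter_upwards [hF] with x hx
  rw [hx]

theorem inner_dirichlet_left (f g : P.L2 𝕜) :
    inner 𝕜 (P.dirichlet 𝕜 f : P.L2 𝕜) g =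
      -∫ x in Ioo 0 P.l, inner 𝕜 (meanZeroPrimitive P.l f x) (meanZeroPrimitive P.l g x) :=
  P.inner_primitive_eq (integrable_meanZeroPrimitive (integrable_L2 f))
    (integral_meanZeroPrimitive P.l_pos (integrable_L2 f)) (P.coeFn_dirichlet f) g

/-- The solution operator of the Dirichlet problem is symmetric in `L²(0, l)`. -/
theorem inner_dirichlet_comm (f g : P.L2 𝕜) :
    inner 𝕜 (P.dirichlet 𝕜 f : P.L2 𝕜) g = inner 𝕜 f (P.dirichlet 𝕜 g : P.L2 𝕜) := by
  rw [← inner_conj_symm f, inner_dirichlet_left, inner_dirichlet_left, map_neg, ← integral_conj]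
  simp only [inner_conj_symm]

/-- The derivative of the hat function: `l - l₀` on `(0, l₀)` and `-l₀` on `(l₀, l)`. -/
def hatSlope (𝕜 : Type*) [RCLike 𝕜] (x : ℝ) : 𝕜 :=
  if x < P.l₀ then ((P.l - P.l₀ : ℝ) : 𝕜) else ((-P.l₀ : ℝ) : 𝕜)

theorem memLp_hatSlope : MemLp (P.hatSlope 𝕜) 2 (volume.restrict (Ioo 0 P.l)) := by
  refine MemLp.of_bound (C := P.l) (Measurable.aestronglyMeasurable
    (Measurable.ite measurableSet_Iio measurable_const measurable_const))
    (Eventually.of_forall fun x => ?_)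
  have h1 := P.l₀_pos
  have h2 := P.l₀_lt
  unfold hatSlope
  split_ifs
  · rw [RCLike.norm_ofReal, abs_of_pos (by linarith)]; linarith
  · rw [RCLike.norm_ofReal, abs_neg, abs_of_pos h1]; linarith

theorem integrable_hatSlope : Integrable (P.hatSlope 𝕜) (volume.restrict (Ioo 0 P.l)) :=
  memLp_integrable P.memLp_hatSlope

theorem integral_hatSlope_mul {f : ℝ → 𝕜} (hf : Integrable f (volume.restrict (Ioo 0 P.l))) :
    ∫ x in Ioo 0 P.l, P.hatSlope 𝕜 x * f x =
      (P.l : 𝕜) * (∫ x in (0 : ℝ)..P.l₀, f x) - (P.l₀ : 𝕜) * ∫ x in Ioo 0 P.l, f x := by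
  have e : ∀ x, P.hatSlope 𝕜 x * f x =
      (P.l : 𝕜) * (Iio P.l₀).indicator f x - (P.l₀ : 𝕜) * f x := fun x => by
    by_cases hx : x < P.l₀
    · simp [hatSlope, hx, sub_mul]
    · simp [hatSlope, hx]
  simp only [e]
  rw [integral_sub ((hf.indicator measurableSet_Iio).const_mul _) (hf.const_mul _),
    integral_const_mul, integral_const_mul, integral_indicator measurableSet_Iio,
    Measure.restrict_restrict measurableSet_Iio,
    show Iio P.l₀ ∩ Ioo 0 P.l = Ioo 0 P.l₀ by
      ext x; simp only [mem_inter_iff, mem_Iio, mem_Ioo]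
      exact ⟨fun h => ⟨h.2.1, h.1⟩, fun h => ⟨h.2, h.1, h.2.trans P.l₀_lt⟩⟩,
    intervalIntegral.integral_of_le P.l₀_pos.le, integral_Ioc_eq_integral_Ioo]

theorem integral_hatSlope : ∫ x in Ioo 0 P.l, P.hatSlope 𝕜 x = 0 := by
  have := P.integral_hatSlope_mul (𝕜 := 𝕜) (f := fun _ => 1) (integrable_const _)
  simp only [mul_one] at this
  rw [this, intervalIntegral.integral_const, integral_const]
  simp [P.l_pos.le, RCLike.real_smul_eq_coe_mul]
  ring

/-- The hat function `h` with `h(0) = h(l) = 0`, which is affine on `(0, l₀)` and on `(l₀, l)` and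
whose derivative drops by `l` at `l₀`. -/
def hat (𝕜 : Type*) [RCLike 𝕜] : P.L2 𝕜 :=
  MemLp.toLp (fun x => ∫ t in (0 : ℝ)..x, P.hatSlope 𝕜 t)
    (memLp_of_continuousOn_Icc (continuousOn_primitive P.integrable_hatSlope))

theorem coeFn_hat : P.hat 𝕜 =ᵐ[volume.restrict (Ioo 0 P.l)]
    fun x => ∫ t in (0 : ℝ)..x, P.hatSlope 𝕜 t :=
  MemLp.coeFn_toLp _

/-- The hat function represents evaluation at `l₀`: it is `-l` times the Green function of the
Dirichlet problem with pole `l₀`. -/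
theorem inner_hat_secondDeriv (u : P.H2₀ 𝕜) :
    inner 𝕜 (P.hat 𝕜) (P.secondDeriv u) = -((P.l : 𝕜) * P.evalL₀ u) := by
  obtain ⟨g, rfl⟩ : ∃ g, P.dirichlet 𝕜 g = u := ⟨_, P.dirichlet_secondDeriv u⟩
  have hg := integrable_L2 g
  rw [secondDeriv_dirichlet, evalL₀_dirichlet_eq,
    P.inner_primitive_eq P.integrable_hatSlope P.integral_hatSlope P.coeFn_hat]
  have e : ∀ x, inner 𝕜 (P.hatSlope 𝕜 x) (meanZeroPrimitive P.l g x) =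
      P.hatSlope 𝕜 x * meanZeroPrimitive P.l g x := fun x => by
    rw [RCLike.inner_apply', hatSlope]
    split_ifs <;> rw [RCLike.conj_ofReal]
  simp only [e]
  rw [P.integral_hatSlope_mul (integrable_meanZeroPrimitive hg),
    integral_meanZeroPrimitive P.l_pos hg, mul_zero, sub_zero, dirichletSolution]

/-! ### The domain in terms of the Dirichlet problem -/

/-- The bending profile `u''` of a deflection whose piecewise fourth derivative is `g` and whose
third derivative drops by `l β` at `l₀`. -/
def profile (g : P.L2 𝕜) (β : 𝕜) : P.L2 𝕜 := (P.dirichlet 𝕜 g : P.L2 𝕜) + β • P.hat 𝕜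

/-- The continuous representative of `profile g β`. -/
def profileFun (g : P.L2 𝕜) (β : 𝕜) (x : ℝ) : 𝕜 :=
  ∫ t in (0 : ℝ)..x, (meanZeroPrimitive P.l g t + β * P.hatSlope 𝕜 t)

theorem integrable_profileSlope (g : P.L2 𝕜) (β : 𝕜) :
    Integrable (fun t => meanZeroPrimitive P.l g t + β * P.hatSlope 𝕜 t)
      (volume.restrict (Ioo 0 P.l)) :=
  (integrable_meanZeroPrimitive (integrable_L2 g)).add (P.integrable_hatSlope.const_mul β)

theorem continuousOn_profileFun (g : P.L2 𝕜) (β : 𝕜) :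
    ContinuousOn (P.profileFun g β) (Icc 0 P.l) :=
  continuousOn_primitive (P.integrable_profileSlope g β)

theorem profileFun_left (g : P.L2 𝕜) (β : 𝕜) : P.profileFun g β 0 = 0 :=
  intervalIntegral.integral_same

theorem profileFun_right (g : P.L2 𝕜) (β : 𝕜) : P.profileFun g β P.l = 0 := by
  rw [profileFun, intervalIntegral.integral_of_le P.l_pos.le, integral_Ioc_eq_integral_Ioo,
    integral_add (integrable_meanZeroPrimitive (integrable_L2 g))
      (P.integrable_hatSlope.const_mul β), integral_const_mul, integral_hatSlope,
    integral_meanZeroPrimitive P.l_pos (integrable_L2 g)]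
  simp

theorem coeFn_profile (g : P.L2 𝕜) (β : 𝕜) :
    P.profile g β =ᵐ[volume.restrict (Ioo 0 P.l)] P.profileFun g β := by
  have hi : ∀ {f : ℝ → 𝕜}, Integrable f (volume.restrict (Ioo 0 P.l)) → ∀ {x}, x ∈ Ioo 0 P.l →
      IntervalIntegrable f volume 0 x := fun hf x hx =>
    (intervalIntegrable_iff_integrableOn_Ioo_of_le hx.1.le).2
      (hf.mono_measure (Measure.restrict_mono (Ioo_subset_Ioo_right hx.2.le) le_rfl))
  filter_upwards [Lp.coeFn_add (P.dirichlet 𝕜 g : P.L2 𝕜) (β • P.hat 𝕜),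
    Lp.coeFn_smul β (P.hat 𝕜), P.coeFn_dirichlet g, P.coeFn_hat (𝕜 := 𝕜),
    ae_restrict_mem measurableSet_Ioo] with x h1 h2 h3 h4 hx
  rw [profile, h1, Pi.add_apply, h2, Pi.smul_apply, h3, h4, profileFun,
    intervalIntegral.integral_add (hi (integrable_meanZeroPrimitive (integrable_L2 g)) hx)
      (hi (P.integrable_hatSlope.const_mul β) hx), intervalIntegral.integral_const_mul,
    smul_eq_mul, dirichletSolution]

/-- On a subinterval where the slope of the hat function is a constant `s`, the deflection with
profile `profile g β` is of class `H⁴`. -/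
theorem derivs_dirichlet_profile (g : P.L2 𝕜) (β : 𝕜) {c d : ℝ} (hc : 0 ≤ c) (hd : d ≤ P.l)
    (s : 𝕜) (hs : P.hatSlope 𝕜 =ᵐ[volume.restrict (Ioo c d)] fun _ => s) :
    let u : ℝ → 𝕜 := (P.dirichlet 𝕜 (P.profile g β) : P.L2 𝕜)
    MemSobolev c d 4 u ∧
    (weakDeriv c d)^[2] u =ᵐ[volume.restrict (Ioo c d)] P.profileFun g β ∧
    (weakDeriv c d)^[3] u =ᵐ[volume.restrict (Ioo c d)]
      (fun x => β * s + meanZeroPrimitive P.l g x) ∧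
    (weakDeriv c d)^[4] u =ᵐ[volume.restrict (Ioo c d)] g := by
  intro u
  have hsub : Ioo c d ⊆ Ioo 0 P.l := Ioo_subset_Ioo hc hd
  have hsub' : Icc c d ⊆ Icc 0 P.l := Icc_subset_Icc hc hd
  have hm : volume.restrict (Ioo c d) ≤ volume.restrict (Ioo 0 P.l) :=
    Measure.restrict_mono hsub le_rfl
  have hg := integrable_L2 g
  have hw := integrable_L2 (P.profile g β)
  have hp := integrable_meanZeroPrimitive hg
  let f : ℕ → ℝ → 𝕜 := fun i => match i with
    | 0 => u
    | 1 => meanZeroPrimitive P.l (P.profile g β)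
    | 2 => P.profileFun g β
    | 3 => fun x => β * s + meanZeroPrimitive P.l g x
    | _ => g
  have hL : ∀ i ≤ 4, MemLp (f i) 2 (volume.restrict (Ioo c d)) := by
    intro i hi
    interval_cases i
    · exact (Lp.memLp _).mono_measure hm
    · exact (memLp_meanZeroPrimitive hw).mono_measure hm
    · exact memLp_of_continuousOn_Icc ((P.continuousOn_profileFun g β).mono hsub')
    · exact (memLp_const (β * s)).add ((memLp_meanZeroPrimitive hg).mono_measure hm)
    · exact (Lp.memLp g).mono_measure hm
  have hW : ∀ i < 4, HasWeakDeriv c d (f i) (f (i + 1)) := by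
    intro i hi
    interval_cases i
    · exact ((hasWeakDeriv_dirichletSolution hw).congr (P.coeFn_dirichlet _).symm
        (ae_eq_refl _)).mono hc hd
    · exact ((hasWeakDeriv_meanZeroPrimitive hw).congr (ae_eq_refl _)
        (P.coeFn_profile g β)).mono hc hd
    · refine ((hasWeakDeriv_primitive (P.integrable_profileSlope g β)).mono hc hd).congr
        (ae_eq_refl _) ?_
      filter_upwards [hs] with x hx
      rw [hx]
      exact add_comm _ _
    · exact ((hasWeakDeriv_meanZeroPrimitive hg).mono hc hd).const_add _
        (hp.mono_measure hm) (hg.mono_measure hm)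
  have key : ∀ n ≤ 4, MemSobolev c d n u ∧
      (weakDeriv c d)^[n] u =ᵐ[volume.restrict (Ioo c d)] f n := fun n hn =>
    iterate_weakDeriv_of_chain (f := f) (n := n) (fun i hi => hL i (hi.trans hn))
      (fun i hi => hW i (hi.trans_le hn))
  exact ⟨(key 4 le_rfl).1, (key 2 (by omega)).2, (key 3 (by omega)).2, (key 4 le_rfl).2⟩

theorem hatSlope_ae_left :
    P.hatSlope 𝕜 =ᵐ[volume.restrict (Ioo 0 P.l₀)] fun _ => ((P.l - P.l₀ : ℝ) : 𝕜) :=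
  (ae_restrict_iff' measurableSet_Ioo).2 (Eventually.of_forall fun _ hx => if_pos hx.2)

theorem hatSlope_ae_right :
    P.hatSlope 𝕜 =ᵐ[volume.restrict (Ioo P.l₀ P.l)] fun _ => ((-P.l₀ : ℝ) : 𝕜) :=
  (ae_restrict_iff' measurableSet_Ioo).2
    (Eventually.of_forall fun _ hx => if_neg (not_lt.2 hx.1.le))

/-- The element of `D(Ã)` with bending profile `profile g β` and velocity `v`. -/
def domainMk (g : P.L2 𝕜) (β : 𝕜) (v : P.H2₀ 𝕜) : P.State 𝕜 :=
  State.mk (P.dirichlet 𝕜 (P.profile g β)) v (P.evalL₀ (P.dirichlet 𝕜 (P.profile g β)))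
    (P.evalL₀ v)

theorem domainMk_mem (g : P.L2 𝕜) (β : 𝕜) (v : P.H2₀ 𝕜) : P.domainMk g β v ∈ P.domain 𝕜 := by
  obtain ⟨a1, a2, a3, a4⟩ := P.derivs_dirichlet_profile g β le_rfl P.l₀_lt.le _ P.hatSlope_ae_left
  obtain ⟨b1, b2, b3, b4⟩ :=
    P.derivs_dirichlet_profile g β P.l₀_pos.le le_rfl _ P.hatSlope_ae_right
  have ca := (P.continuousOn_profileFun g β).mono (Icc_subset_Icc_right P.l₀_lt.le)
  have cb := (P.continuousOn_profileFun g β).mono (Icc_subset_Icc_left P.l₀_pos.le)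
  refine ⟨⟨a1, b1⟩, ?_, ?_, ?_, ⟨v.2, rfl⟩, rfl⟩
  · exact (pointValue_eq P.l₀_pos ca a2 (left_mem_Icc.2 P.l₀_pos.le)).trans (P.profileFun_left g β)
  · exact (pointValue_eq P.l₀_lt cb b2 (right_mem_Icc.2 P.l₀_lt.le)).trans (P.profileFun_right g β)
  · exact (pointValue_eq P.l₀_pos ca a2 (right_mem_Icc.2 P.l₀_pos.le)).trans
      (pointValue_eq P.l₀_lt cb b2 (left_mem_Icc.2 P.l₀_lt.le)).symm

theorem shearJump_domainMk (g : P.L2 𝕜) (β : 𝕜) (v : P.H2₀ 𝕜) :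
    P.shearJump ⟨P.domainMk g β v, P.domainMk_mem g β v⟩ =
      ((P.E * P.I : ℝ) : 𝕜) * ((P.l : 𝕜) * β) := by
  obtain ⟨-, -, a3, -⟩ := P.derivs_dirichlet_profile g β le_rfl P.l₀_lt.le _ P.hatSlope_ae_left
  obtain ⟨-, -, b3, -⟩ :=
    P.derivs_dirichlet_profile g β P.l₀_pos.le le_rfl _ P.hatSlope_ae_right
  have hc : ∀ z : 𝕜, ContinuousOn (fun x => z + meanZeroPrimitive P.l g x) (Icc 0 P.l) :=
    fun z => continuousOn_const.add (continuousOn_meanZeroPrimitive (integrable_L2 g))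
  have e1 := pointValue_eq P.l₀_pos ((hc _).mono (Icc_subset_Icc_right P.l₀_lt.le)) a3
    (right_mem_Icc.2 P.l₀_pos.le)
  have e2 := pointValue_eq P.l₀_lt ((hc _).mono (Icc_subset_Icc_left P.l₀_pos.le)) b3
    (left_mem_Icc.2 P.l₀_lt.le)
  unfold shearJump leftDerivAt rightDerivAt
  simp only [domainMk, State.u_mk]
  rw [e1, e2]
  push_cast
  ring

theorem fourthDeriv_domainMk (g : P.L2 𝕜) (β : 𝕜) (v : P.H2₀ 𝕜) :
    P.fourthDeriv ⟨P.domainMk g β v, P.domainMk_mem g β v⟩ = g := by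
  obtain ⟨-, -, -, a4⟩ := P.derivs_dirichlet_profile g β le_rfl P.l₀_lt.le _ P.hatSlope_ae_left
  obtain ⟨-, -, -, b4⟩ :=
    P.derivs_dirichlet_profile g β P.l₀_pos.le le_rfl _ P.hatSlope_ae_right
  refine Lp.ext ((MemLp.coeFn_toLp (memLp_fourthDerivFun (P.domainMk_mem g β v).1)).trans ?_)
  have a5 := ae_restrict_indicator measurableSet_Ioo a4 (Ioo 0 P.l)
  have b5 := ae_restrict_indicator measurableSet_Ioo b4 (Ioo 0 P.l)
  have h0 : ∀ᵐ x ∂(volume.restrict (Ioo 0 P.l)), x ≠ P.l₀ :=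
    ae_restrict_of_ae (Measure.ae_ne volume P.l₀)
  filter_upwards [a5, b5, h0, ae_restrict_mem measurableSet_Ioo] with x ha hb hx hx'
  simp only [fourthDerivFun, Pi.add_apply, domainMk, State.u_mk]
  rw [ha, hb]
  rcases lt_or_gt_of_ne hx with h | h
  · rw [indicator_of_mem (show x ∈ Ioo 0 P.l₀ from ⟨hx'.1, h⟩),
      indicator_of_notMem fun h' => h.not_gt h'.1, add_zero]
  · rw [indicator_of_notMem fun h' => h.not_gt h'.2,
      indicator_of_mem (show x ∈ Ioo P.l₀ P.l from ⟨h, hx'.2⟩), zero_add]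

theorem ae_of_ae_left_of_ae_right {p : ℝ → Prop} (h1 : ∀ᵐ x ∂(volume.restrict (Ioo 0 P.l₀)), p x)
    (h2 : ∀ᵐ x ∂(volume.restrict (Ioo P.l₀ P.l)), p x) :
    ∀ᵐ x ∂(volume.restrict (Ioo 0 P.l)), p x := by
  rw [ae_restrict_iff' measurableSet_Ioo] at h1 h2 ⊢
  filter_upwards [h1, h2, Measure.ae_ne volume P.l₀] with x k1 k2 hx hx'
  rcases lt_or_gt_of_ne hx with h | h
  · exact k1 ⟨hx'.1, h⟩
  · exact k2 ⟨h, hx'.2⟩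

theorem coeFn_fourthDeriv (ξ : P.domain 𝕜) : P.fourthDeriv ξ =ᵐ[volume.restrict (Ioo 0 P.l)]
    P.fourthDerivFun ((ξ : P.State 𝕜).u : P.L2 𝕜) :=
  MemLp.coeFn_toLp (memLp_fourthDerivFun ξ.2.1)

/-- With no load, no shear force jump and simply supported ends, the bending moment of a piecewise
`H⁴` deflection is affine on all of `(0, l)` and vanishes at both ends. -/
theorem secondDeriv_ae_eq_zero {u : ℝ → 𝕜} (hu : P.PiecewiseH4 u) (hu2 : MemSobolev 0 P.l 2 u)
    (hl : P.leftDerivAt 2 u 0 = 0) (hr : P.rightDerivAt 2 u P.l = 0)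
    (hc : P.leftDerivAt 2 u P.l₀ = P.rightDerivAt 2 u P.l₀)
    (hJ : P.leftDerivAt 3 u P.l₀ = P.rightDerivAt 3 u P.l₀)
    (h4 : P.fourthDerivFun u =ᵐ[volume.restrict (Ioo 0 P.l)] 0) :
    (weakDeriv 0 P.l)^[2] u =ᵐ[volume.restrict (Ioo 0 P.l)] 0 := by
  have hL : (weakDeriv 0 P.l₀)^[4] u =ᵐ[volume.restrict (Ioo 0 P.l₀)] 0 := by
    filter_upwards [ae_left h4, ae_restrict_mem measurableSet_Ioo] with x hx hx'
    rw [← hx, fourthDerivFun, Pi.add_apply, indicator_of_mem hx',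
      indicator_of_notMem fun h => hx'.2.not_gt h.1, add_zero]
  have hR : (weakDeriv P.l₀ P.l)^[4] u =ᵐ[volume.restrict (Ioo P.l₀ P.l)] 0 := by
    filter_upwards [ae_right h4, ae_restrict_mem measurableSet_Ioo] with x hx hx'
    rw [← hx, fourthDerivFun, Pi.add_apply, indicator_of_mem hx',
      indicator_of_notMem fun h => hx'.1.not_gt h.2, zero_add]
  obtain ⟨r, s, k1, k2, k3⟩ := exists_affine_of_fourth_deriv_eq_zero P.l₀_pos hu.1 hL
  obtain ⟨r', s', m1, m2, m3⟩ := exists_affine_of_fourth_deriv_eq_zero P.l₀_lt hu.2 hR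
  have i1 := left_mem_Icc.2 P.l₀_pos.le
  have i2 := right_mem_Icc.2 P.l₀_pos.le
  have i3 := left_mem_Icc.2 P.l₀_lt.le
  have i4 := right_mem_Icc.2 P.l₀_lt.le
  unfold leftDerivAt at hl hc hJ
  unfold rightDerivAt at hr hc hJ
  rw [k2 _ i1, sub_self, RCLike.ofReal_zero, zero_mul, add_zero] at hl
  rw [m2 _ i4] at hr
  rw [k2 _ i2, m2 _ i3, hl, sub_self, RCLike.ofReal_zero, zero_mul, add_zero, zero_add,
    sub_zero] at hc
  have hs : s = s' := by rwa [k3 _ i2, m3 _ i3] at hJ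
  have hs0 : s = 0 := by
    have : (P.l : 𝕜) * s = 0 := by
      rw [← hr, ← hc, ← hs]; push_cast; ring
    exact (mul_eq_zero.1 this).resolve_left (RCLike.ofReal_ne_zero.2 P.l_pos.ne')
  have hr0 : r' = 0 := by rw [← hc, hs0, mul_zero]
  refine P.ae_of_ae_left_of_ae_right ?_ ?_
  · filter_upwards [iterate_weakDeriv_mono le_rfl P.l₀_lt.le hu2, k1] with x h1 h2
    rw [← h1, h2, hl, hs0]; simp
  · filter_upwards [iterate_weakDeriv_mono P.l₀_pos.le le_rfl hu2, m1] with x h1 h2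
    rw [← h1, h2, hr0, ← hs, hs0]; simp

/-- A deflection in the domain is determined by its piecewise fourth derivative and the jump
of the shear force. -/
theorem u_eq_zero_of_fourthDeriv_eq_zero (ξ : P.domain 𝕜) (h4 : P.fourthDeriv ξ = 0)
    (hJ : P.shearJump ξ = 0) : (ξ : P.State 𝕜).u = 0 := by
  have hE : ((P.E * P.I : ℝ) : 𝕜) ≠ 0 := RCLike.ofReal_ne_zero.2 (mul_pos P.E_pos P.I_pos).ne'
  have h4' := (P.coeFn_fourthDeriv ξ).symm
  rw [h4] at h4'
  have hu2 := (ξ : P.State 𝕜).u.2.1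
  refine P.secondDeriv_eq_zero (Lp.ext ?_)
  refine (MemLp.coeFn_toLp (MemSobolev.iterate (n := 0) (i := 2) hu2).memLp).trans ?_
  refine EventuallyEq.trans ?_ (Lp.coeFn_zero _ _ _).symm
  exact P.secondDeriv_ae_eq_zero ξ.2.1 hu2 ξ.2.2.1 ξ.2.2.2.1 ξ.2.2.2.2.1
    (sub_eq_zero.1 ((mul_eq_zero.1 hJ).resolve_left hE)) (h4'.trans (Lp.coeFn_zero _ _ _))

/-- Every element of the domain arises from its piecewise fourth derivative, its shear force jump
and its velocity. -/
theorem eq_domainMk (ξ : P.domain 𝕜) (β : 𝕜)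
    (hβ : P.shearJump ξ = ((P.E * P.I : ℝ) : 𝕜) * ((P.l : 𝕜) * β))
    (hv : (ξ : P.State 𝕜).v ∈ P.H2₀ 𝕜) :
    (ξ : P.State 𝕜) = P.domainMk (P.fourthDeriv ξ) β ⟨(ξ : P.State 𝕜).v, hv⟩ := by
  set η : P.domain 𝕜 :=
    ⟨P.domainMk (P.fourthDeriv ξ) β ⟨(ξ : P.State 𝕜).v, hv⟩, P.domainMk_mem _ _ _⟩ with hη
  have hu : (ξ : P.State 𝕜).u = (η : P.State 𝕜).u := by
    have key := P.u_eq_zero_of_fourthDeriv_eq_zero (ξ + (-1 : 𝕜) • η)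
      (by rw [map_add, map_smul, hη, fourthDeriv_domainMk]; simp)
      (by rw [shearJump_add, shearJump_smul, hη, shearJump_domainMk, hβ]; ring)
    rw [Submodule.coe_add, Submodule.coe_smul, State.u_add, State.u_smul, neg_one_smul,
      add_neg_eq_zero] at key
    exact key
  obtain ⟨-, -, -, -, ⟨hv', hq⟩, hp⟩ := ξ.2
  exact State.ext hu rfl (by rw [hp, hu]; rfl) hq

/-- Green's formula on the domain: integration by parts produces the shear force jump as the only
boundary term. -/
theorem inner_secondDeriv_profile (g : P.L2 𝕜) (β : 𝕜) (v : P.H2₀ 𝕜) :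
    inner 𝕜 (P.profile g β) (P.secondDeriv v) =
      inner 𝕜 g (v : P.L2 𝕜) - (starRingEnd 𝕜) β * ((P.l : 𝕜) * P.evalL₀ v) := by
  rw [profile, inner_add_left, inner_smul_left, inner_hat_secondDeriv, inner_dirichlet_comm,
    dirichlet_secondDeriv]
  ring

end Green

/-! ### Dissipativity -/

section Dissipative

variable {𝕜 : Type*} [RCLike 𝕜] (P : BeamSystem)

theorem inner_state (ξ η : P.State 𝕜) : inner 𝕜 ξ η =
    ((P.E * P.I : ℝ) : 𝕜) * inner 𝕜 (P.secondDeriv ξ.u) (P.secondDeriv η.u) +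
    (P.ρ : 𝕜) * inner 𝕜 ξ.v η.v + (P.ϰ : 𝕜) * inner 𝕜 ξ.p η.p + (P.m : 𝕜) * inner 𝕜 ξ.q η.q :=
  rfl

theorem norm_sq_state (ξ : P.State 𝕜) : ‖ξ‖ ^ 2 =
    P.E * P.I * ‖P.secondDeriv ξ.u‖ ^ 2 + P.ρ * ‖ξ.v‖ ^ 2 + P.ϰ * ‖ξ.p‖ ^ 2 + P.m * ‖ξ.q‖ ^ 2 := by
  rw [← inner_self_eq_norm_sq (𝕜 := 𝕜), inner_state]
  simp only [map_add, RCLike.re_ofReal_mul, inner_self_eq_norm_sq]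

theorem distControl_eq (j : Fin P.k) (v : P.L2 𝕜) :
    P.distControl j v = -(P.α j : 𝕜) * inner 𝕜 (P.ψL2 𝕜 j) v := by
  change -(P.α j : 𝕜) * ∫ x in Ioo 0 P.l, (P.ψdd j x : 𝕜) * v x = _
  rw [L2.inner_def]
  congr 1
  refine integral_congr_ae ?_
  filter_upwards [MemLp.coeFn_toLp (P.memLp_ψdd (𝕜 := 𝕜) j)] with x hx
  rw [ψL2, hx, RCLike.inner_apply', RCLike.conj_ofReal]

theorem generator_apply (ξ : P.domain 𝕜) (hv : (ξ : P.State 𝕜).v ∈ P.H2₀ 𝕜) :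
    P.generator 𝕜 ξ = State.mk ⟨(ξ : P.State 𝕜).v, hv⟩
        (-((P.E * P.I / P.ρ : ℝ) : 𝕜) • P.fourthDeriv ξ +
          ((1 / P.ρ : ℝ) : 𝕜) • ∑ j, P.distControl j (ξ : P.State 𝕜).v • P.ψL2 𝕜 j)
        (ξ : P.State 𝕜).q
        (((1 / P.m : ℝ) : 𝕜) * (P.shearJump ξ - (P.ϰ : 𝕜) * (ξ : P.State 𝕜).p +
          P.lumpedControl (ξ : P.State 𝕜).q)) :=
  rfl

theorem exists_shearJump_eq (ξ : P.domain 𝕜) :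
    ∃ β : 𝕜, P.shearJump ξ = ((P.E * P.I : ℝ) : 𝕜) * ((P.l : 𝕜) * β) := by
  have h1 : ((P.E * P.I : ℝ) : 𝕜) ≠ 0 := RCLike.ofReal_ne_zero.2 (mul_pos P.E_pos P.I_pos).ne'
  have h2 : (P.l : 𝕜) ≠ 0 := RCLike.ofReal_ne_zero.2 P.l_pos.ne'
  exact ⟨P.shearJump ξ / (((P.E * P.I : ℝ) : 𝕜) * (P.l : 𝕜)), by field_simp⟩

/-- The energy balance: the generator dissipates energy through the feedback controls. -/
theorem re_inner_generator (ξ : P.domain 𝕜) :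
    RCLike.re (inner 𝕜 (ξ : P.State 𝕜) (P.generator 𝕜 ξ)) =
      -(∑ j, P.α j * ‖(inner 𝕜 (P.ψL2 𝕜 j) (ξ : P.State 𝕜).v : 𝕜)‖ ^ 2) -
        P.α₀ * ‖(ξ : P.State 𝕜).q‖ ^ 2 := by
  obtain ⟨hv, hq⟩ := ξ.2.2.2.2.2.1
  obtain ⟨β, hβ⟩ := P.exists_shearJump_eq ξ
  have hξ := P.eq_domainMk ξ β hβ hv
  have hu : P.secondDeriv (ξ : P.State 𝕜).u = P.profile (P.fourthDeriv ξ) β := by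
    rw [hξ]; exact P.secondDeriv_dirichlet _
  have hρ : (P.ρ : 𝕜) ≠ 0 := RCLike.ofReal_ne_zero.2 P.ρ_pos.ne'
  have hm : (P.m : 𝕜) ≠ 0 := RCLike.ofReal_ne_zero.2 P.m_pos.ne'
  rw [P.generator_apply ξ hv, inner_state, hβ]
  simp only [State.u_mk, State.v_mk, State.p_mk, State.q_mk, hu]
  rw [inner_secondDeriv_profile, ← hq, inner_add_right, inner_smul_right, inner_smul_right,
    inner_sum]
  simp only [inner_smul_right, distControl_eq, lumpedControl, RCLike.inner_apply']
  set q := (ξ : P.State 𝕜).q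
  set p := (ξ : P.State 𝕜).p
  set v := (ξ : P.State 𝕜).v
  set g := P.fourthDeriv ξ
  have hsum : ∑ j, -(P.α j : 𝕜) * inner 𝕜 (P.ψL2 𝕜 j) v * inner 𝕜 v (P.ψL2 𝕜 j) =
      ((-(∑ j, P.α j * ‖(inner 𝕜 (P.ψL2 𝕜 j) v : 𝕜)‖ ^ 2) : ℝ) : 𝕜) := by
    push_cast
    rw [← Finset.sum_neg_distrib]
    refine Finset.sum_congr rfl fun j _ => ?_
    rw [mul_assoc, ← inner_conj_symm v, RCLike.mul_conj, neg_mul]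
  rw [hsum, ← inner_conj_symm v g]
  -- up to terms `z - z̄`, only the dissipation remains
  have hre : ∀ z : 𝕜, RCLike.re (z - (starRingEnd 𝕜) z) = 0 := fun z => by simp
  have key : ((P.E * P.I : ℝ) : 𝕜) * (inner 𝕜 g v - (starRingEnd 𝕜) β * ((P.l : 𝕜) * q)) +
      (P.ρ : 𝕜) * (-((P.E * P.I / P.ρ : ℝ) : 𝕜) * (starRingEnd 𝕜) (inner 𝕜 g v) +
        ((1 / P.ρ : ℝ) : 𝕜) *
          ((-(∑ j, P.α j * ‖(inner 𝕜 (P.ψL2 𝕜 j) v : 𝕜)‖ ^ 2) : ℝ) : 𝕜)) +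
      (P.ϰ : 𝕜) * ((starRingEnd 𝕜) p * q) +
      (P.m : 𝕜) * ((starRingEnd 𝕜) q * (((1 / P.m : ℝ) : 𝕜) *
        (((P.E * P.I : ℝ) : 𝕜) * ((P.l : 𝕜) * β) - (P.ϰ : 𝕜) * p + -(P.α₀ : 𝕜) * q))) =
      ((P.E * P.I : ℝ) : 𝕜) * (inner 𝕜 g v - (starRingEnd 𝕜) (inner 𝕜 g v)) +
      (P.ϰ : 𝕜) * ((starRingEnd 𝕜) p * q - (starRingEnd 𝕜) ((starRingEnd 𝕜) p * q)) +
      ((P.E * P.I * P.l : ℝ) : 𝕜) *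
        ((starRingEnd 𝕜) q * β - (starRingEnd 𝕜) ((starRingEnd 𝕜) q * β)) +
      ((-(∑ j, P.α j * ‖(inner 𝕜 (P.ψL2 𝕜 j) v : 𝕜)‖ ^ 2) - P.α₀ * ‖q‖ ^ 2 : ℝ) : 𝕜) := by
    have hqq : (((‖q‖ ^ 2 : ℝ)) : 𝕜) = (starRingEnd 𝕜) q * q := by
      rw [RCLike.conj_mul]; push_cast; rfl
    rw [RCLike.ofReal_sub, RCLike.ofReal_mul P.α₀, hqq]
    simp only [map_mul, RCLike.conj_conj, RCLike.ofReal_div, RCLike.ofReal_one,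
      RCLike.ofReal_mul P.E, RCLike.ofReal_mul (P.E * P.I)]
    field_simp
    ring
  rw [key, map_add, map_add, map_add, RCLike.re_ofReal_mul, RCLike.re_ofReal_mul,
    RCLike.re_ofReal_mul, hre, hre, hre, RCLike.ofReal_re]
  ring

theorem re_inner_generator_nonpos (ξ : P.domain 𝕜) :
    RCLike.re (inner 𝕜 (ξ : P.State 𝕜) (P.generator 𝕜 ξ)) ≤ 0 := by
  rw [re_inner_generator]
  have h1 : 0 ≤ ∑ j, P.α j * ‖(inner 𝕜 (P.ψL2 𝕜 j) (ξ : P.State 𝕜).v : 𝕜)‖ ^ 2 :=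
    Finset.sum_nonneg fun j _ => mul_nonneg (P.α_pos j).le (sq_nonneg _)
  have h2 : 0 ≤ P.α₀ * ‖(ξ : P.State 𝕜).q‖ ^ 2 := mul_nonneg P.α₀_pos.le (sq_nonneg _)
  linarith

end Dissipative

/-! ### Compactness of the Dirichlet solution operator -/

section Compact

variable {𝕜 : Type*} [RCLike 𝕜] (P : BeamSystem)

theorem exists_integral_norm_le :
    ∃ C : ℝ, 0 ≤ C ∧ ∀ g : P.L2 𝕜, ∫ x in Ioo 0 P.l, ‖g x‖ ≤ C * ‖g‖ := by
  set μ := volume.restrict (Ioo 0 P.l) with hμ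
  refine ⟨(μ univ ^ (1 / (1 : ENNReal).toReal - 1 / (2 : ENNReal).toReal)).toReal,
    ENNReal.toReal_nonneg, fun g => ?_⟩
  have h1 := eLpNorm_le_eLpNorm_mul_rpow_measure_univ (μ := μ) (p := 1) (q := 2)
    one_le_two (Lp.memLp g).1
  rw [integral_norm_eq_lintegral_enorm (Lp.memLp g).1, ← eLpNorm_one_eq_lintegral_enorm,
    Lp.norm_def, mul_comm, ← ENNReal.toReal_mul]
  refine ENNReal.toReal_mono (ENNReal.mul_ne_top (Lp.eLpNorm_ne_top g) ?_) h1
  exact ENNReal.rpow_ne_top_of_nonneg (by norm_num) (measure_ne_top μ univ)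

/-- By the Arzelà–Ascoli theorem, the Dirichlet solution operator is compact in `L²(0, l)`. -/
theorem isCompactOperator_dirichlet :
    IsCompactOperator ((P.H2₀ 𝕜).subtype ∘ₗ P.dirichlet 𝕜) := by
  have : Fact ((1 : ENNReal) ≤ 2) := ⟨one_le_two⟩
  obtain ⟨C, hC0, hC⟩ := P.exists_integral_norm_le (𝕜 := 𝕜)
  rw [isCompactOperator_iff_image_closedBall_subset_compact _ one_pos]
  let S : Set (BoundedContinuousFunction (Icc 0 P.l) 𝕜) :=
    {f | (∀ x, ‖f x‖ ≤ 2 * C * P.l) ∧ ∀ x y, dist (f x) (f y) ≤ 2 * C * dist x y}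
  have hS : IsCompact (closure S) := by
    refine BoundedContinuousFunction.arzela_ascoli (Metric.closedBall 0 (2 * C * P.l))
      (isCompact_closedBall _ _) S
      (fun f x hf => mem_closedBall_zero_iff.2 (hf.1 x)) ?_
    refine Metric.equicontinuous_of_continuity_modulus (fun t => 2 * C * t) ?_ _
      (fun x y f => f.2.2 x y)
    have : Continuous fun t : ℝ => 2 * C * t := by fun_prop
    simpa using this.tendsto 0
  let Φ : BoundedContinuousFunction (Icc 0 P.l) 𝕜 → P.L2 𝕜 := fun f =>
    BoundedContinuousFunction.toLp 2 (volume.restrict (Ioo 0 P.l)) 𝕜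
      (f.compContinuous ⟨projIcc 0 P.l P.l_pos.le, continuous_projIcc⟩)
  have hΦ : Continuous Φ := (ContinuousLinearMap.continuous _).comp
    (BoundedContinuousFunction.continuous_compContinuous _)
  refine ⟨Φ '' closure S, hS.image hΦ, ?_⟩
  rintro _ ⟨g, hg, rfl⟩
  have hgi := integrable_L2 g
  have hI : ∫ x in Ioo 0 P.l, ‖g x‖ ≤ C :=
    (hC g).trans (mul_le_of_le_one_right hC0 (mem_closedBall_zero_iff.1 hg))
  let f : BoundedContinuousFunction (Icc 0 P.l) 𝕜 := BoundedContinuousFunction.mkOfCompact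
    ⟨fun x => dirichletSolution P.l g x, (continuousOn_dirichletSolution hgi).domRestrict⟩
  have hf : ∀ x y : Icc 0 P.l, dist (f x) (f y) ≤ 2 * C * dist x y := fun x y => by
    rw [dist_eq_norm, Subtype.dist_eq, Real.dist_eq]
    refine (norm_dirichletSolution_sub_le P.l_pos hgi x.2 y.2).trans ?_
    gcongr
  refine ⟨f, subset_closure ⟨fun x => ?_, hf⟩, ?_⟩
  · have h0 := hf x ⟨0, left_mem_Icc.2 P.l_pos.le⟩
    have h1 : f ⟨0, left_mem_Icc.2 P.l_pos.le⟩ = 0 := dirichletSolution_left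
    rw [h1, dist_zero_right, Subtype.dist_eq, Real.dist_eq, sub_zero, abs_of_nonneg x.2.1] at h0
    exact h0.trans (by gcongr; exact x.2.2)
  · refine Lp.ext ((BoundedContinuousFunction.coeFn_toLp _ _ _ _).trans ?_)
    refine EventuallyEq.trans ?_ (P.coeFn_dirichlet g).symm
    filter_upwards [ae_restrict_mem measurableSet_Ioo] with x hx
    simp only [BoundedContinuousFunction.compContinuous_apply, ContinuousMap.coe_mk]
    rw [projIcc_of_mem _ (Ioo_subset_Icc_self hx)]
    rfl

/-- The Dirichlet solution operator as a bounded operator in `L²(0, l)`. -/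
def dirichletL (𝕜 : Type*) [RCLike 𝕜] : P.L2 𝕜 →L[𝕜] P.L2 𝕜 :=
  .mkOfIsCompactOperator P.isCompactOperator_dirichlet

@[simp] theorem dirichletL_apply (g : P.L2 𝕜) : P.dirichletL 𝕜 g = P.dirichlet 𝕜 g := rfl

theorem isCompactOperator_dirichletL : IsCompactOperator (P.dirichletL 𝕜) :=
  P.isCompactOperator_dirichlet

/-- The functional `g ↦ u(l₀)` on `L²(0, l)`, where `u'' = g` and `u(0) = u(l) = 0`. -/
def evalL (𝕜 : Type*) [RCLike 𝕜] : P.L2 𝕜 →L[𝕜] 𝕜 := -(P.l : 𝕜)⁻¹ • innerSL 𝕜 (P.hat 𝕜)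

theorem evalL_apply (g : P.L2 𝕜) : P.evalL 𝕜 g = -(P.l : 𝕜)⁻¹ * inner 𝕜 (P.hat 𝕜) g := rfl

theorem evalL_secondDeriv (u : P.H2₀ 𝕜) : P.evalL 𝕜 (P.secondDeriv u) = P.evalL₀ u := by
  have h : (P.l : 𝕜) ≠ 0 := RCLike.ofReal_ne_zero.2 P.l_pos.ne'
  rw [evalL_apply, inner_hat_secondDeriv]
  field_simp

theorem evalL₀_dirichlet (g : P.L2 𝕜) : P.evalL₀ (P.dirichlet 𝕜 g) = P.evalL 𝕜 g := by
  rw [← evalL_secondDeriv, secondDeriv_dirichlet]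

end Compact

/-! ### The state space as a Hilbert space -/

section Space

variable {𝕜 : Type*} [RCLike 𝕜] (P : BeamSystem)

/-- The coordinates `(u'', v, p, q)` of a state. -/
def coordsₗ (𝕜 : Type*) [RCLike 𝕜] : P.State 𝕜 ≃ₗ[𝕜] P.L2 𝕜 × P.L2 𝕜 × 𝕜 × 𝕜 where
  toFun ξ := (P.secondDeriv ξ.u, ξ.v, ξ.p, ξ.q)
  invFun w := State.mk (P.dirichlet 𝕜 w.1) w.2.1 w.2.2.1 w.2.2.2
  map_add' ξ η := by simp
  map_smul' c ξ := by simp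
  left_inv ξ := State.ext (P.dirichlet_secondDeriv _) rfl rfl rfl
  right_inv w := by simp

theorem le_sqrt_mul_of_mul_sq_le {c a d t : ℝ} (hc : 0 < c) (hd : c⁻¹ ≤ d) (ht : 0 ≤ t)
    (h : c * a ^ 2 ≤ t ^ 2) : a ≤ √d * t := by
  have hd0 : 0 ≤ d := (inv_pos.2 hc).le.trans hd
  have h1 : a ^ 2 ≤ d * t ^ 2 := by
    calc a ^ 2 = c⁻¹ * (c * a ^ 2) := by field_simp
      _ ≤ c⁻¹ * t ^ 2 := by gcongr
      _ ≤ d * t ^ 2 := by gcongr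
  have h2 := Real.le_sqrt_of_sq_le h1
  rwa [Real.sqrt_mul hd0, Real.sqrt_sq ht] at h2

/-- The coordinates `(u'', v, p, q)` identify the state space with `L² × L² × 𝕜²` as a topological
vector space. -/
def coords (𝕜 : Type*) [RCLike 𝕜] : P.State 𝕜 ≃L[𝕜] P.L2 𝕜 × P.L2 𝕜 × 𝕜 × 𝕜 :=
  (P.coordsₗ 𝕜).toContinuousLinearEquivOfBounds
    (√((P.E * P.I)⁻¹ + P.ρ⁻¹ + P.ϰ⁻¹ + P.m⁻¹)) (√(P.E * P.I + P.ρ + P.ϰ + P.m))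
    (fun ξ => by
      have h1 := mul_pos P.E_pos P.I_pos
      have h2 := P.ρ_pos
      have h3 := P.ϰ_pos
      have h4 := P.m_pos
      have i1 := inv_pos.2 h1
      have i2 := inv_pos.2 h2
      have i3 := inv_pos.2 h3
      have i4 := inv_pos.2 h4
      have n1 : 0 ≤ P.E * P.I * ‖P.secondDeriv ξ.u‖ ^ 2 := by positivity
      have n2 : 0 ≤ P.ρ * ‖ξ.v‖ ^ 2 := by positivity
      have n3 : 0 ≤ P.ϰ * ‖ξ.p‖ ^ 2 := by positivity
      have n4 : 0 ≤ P.m * ‖ξ.q‖ ^ 2 := by positivity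
      have hn := P.norm_sq_state ξ
      have key : ∀ {c a : ℝ}, 0 < c → c⁻¹ ≤ (P.E * P.I)⁻¹ + P.ρ⁻¹ + P.ϰ⁻¹ + P.m⁻¹ →
          c * a ^ 2 ≤ ‖ξ‖ ^ 2 → a ≤ √((P.E * P.I)⁻¹ + P.ρ⁻¹ + P.ϰ⁻¹ + P.m⁻¹) * ‖ξ‖ :=
        fun hc hd h => le_sqrt_mul_of_mul_sq_le hc hd (norm_nonneg _) h
      change max ‖P.secondDeriv ξ.u‖ (max ‖ξ.v‖ (max ‖ξ.p‖ ‖ξ.q‖)) ≤ _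
      refine max_le (key h1 (by linarith) (by linarith)) (max_le (key h2 (by linarith)
        (by linarith)) (max_le (key h3 (by linarith) (by linarith)) (key h4 (by linarith)
        (by linarith)))))
    (fun w => by
      have h1 := mul_pos P.E_pos P.I_pos
      have h2 := P.ρ_pos
      have h3 := P.ϰ_pos
      have h4 := P.m_pos
      have n1 : ‖w.1‖ ≤ ‖w‖ := norm_fst_le w
      have n2 : ‖w.2.1‖ ≤ ‖w‖ := (norm_fst_le w.2).trans (norm_snd_le w)
      have n3 : ‖w.2.2.1‖ ≤ ‖w‖ :=
        (norm_fst_le w.2.2).trans ((norm_snd_le w.2).trans (norm_snd_le w))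
      have n4 : ‖w.2.2.2‖ ≤ ‖w‖ :=
        (norm_snd_le w.2.2).trans ((norm_snd_le w.2).trans (norm_snd_le w))
      have hn := P.norm_sq_state
        (State.mk (P.dirichlet 𝕜 w.1) w.2.1 w.2.2.1 w.2.2.2)
      simp only [State.u_mk, State.v_mk, State.p_mk, State.q_mk, secondDeriv_dirichlet] at hn
      have hs := Real.le_sqrt_of_sq_le (hn.trans_le (calc
        _ ≤ P.E * P.I * ‖w‖ ^ 2 + P.ρ * ‖w‖ ^ 2 + P.ϰ * ‖w‖ ^ 2 + P.m * ‖w‖ ^ 2 := by gcongr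
        _ = (P.E * P.I + P.ρ + P.ϰ + P.m) * ‖w‖ ^ 2 := by ring))
      rwa [Real.sqrt_mul (by positivity), Real.sqrt_sq (norm_nonneg _)] at hs)

theorem coords_apply (ξ : P.State 𝕜) :
    P.coords 𝕜 ξ = (P.secondDeriv ξ.u, ξ.v, ξ.p, ξ.q) := rfl

instance : CompleteSpace (P.State 𝕜) :=
  (completeSpace_congr (e := (P.coords 𝕜).toEquiv) (P.coords 𝕜).isUniformEmbedding).2 inferInstance

theorem isClosed_compatible : IsClosed (P.compatible 𝕜 : Set (P.State 𝕜)) := by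
  have e : (P.compatible 𝕜 : Set (P.State 𝕜)) =
      {ξ | (P.coords 𝕜 ξ).2.2.1 = P.evalL 𝕜 (P.coords 𝕜 ξ).1} := by
    ext ξ
    simp only [coords_apply, evalL_secondDeriv]
    rfl
  rw [e]
  have hc := (P.coords 𝕜).continuous
  exact isClosed_eq (continuous_fst.comp (continuous_snd.comp (continuous_snd.comp hc)))
    ((P.evalL 𝕜).continuous.comp (continuous_fst.comp hc))

end Space

/-! ### The inverse of the generator -/

section Inverse

variable {𝕜 : Type*} [RCLike 𝕜] (P : BeamSystem)

/-- The piecewise fourth derivative `u''''` of the solution of `Ã (u, v, p, q) = y`, as a function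
of the coordinates of `y`. It is read off from the second component of the equation, in which the
velocity `v` is the first component of `y`. -/
def load (𝕜 : Type*) [RCLike 𝕜] : P.L2 𝕜 × P.L2 𝕜 × 𝕜 × 𝕜 →L[𝕜] P.L2 𝕜 :=
  ((P.ρ / (P.E * P.I) : ℝ) : 𝕜) •
    (((1 / P.ρ : ℝ) : 𝕜) • (∑ j, ((-(P.α j : 𝕜)) • (innerSL 𝕜 (P.ψL2 𝕜 j) ∘L P.dirichletL 𝕜 ∘L
      ContinuousLinearMap.fst 𝕜 _ _)).smulRight (P.ψL2 𝕜 j)) -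
    ContinuousLinearMap.fst 𝕜 _ _ ∘L ContinuousLinearMap.snd 𝕜 _ _)

/-- The factor of `β` in `L - ϰ p` for a deflection with `u'' = w + β h`: the shear force jump
`E I l β` minus the part `ϰ β` times the deflection at `l₀` with second derivative `h`. -/
def stiffness (𝕜 : Type*) [RCLike 𝕜] : 𝕜 :=
  ((P.E * P.I : ℝ) : 𝕜) * P.l - P.ϰ * P.evalL 𝕜 (P.hat 𝕜)

/-- The stiffness is positive, because evaluation at `l₀` is negative on the hat function. -/
theorem stiffness_ne_zero : P.stiffness 𝕜 ≠ 0 := by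
  have h1 := mul_pos P.E_pos P.I_pos
  have h2 := P.l_pos
  have h3 := P.ϰ_pos
  have e : P.stiffness 𝕜 = ((P.E * P.I * P.l + P.ϰ * P.l⁻¹ * ‖P.hat 𝕜‖ ^ 2 : ℝ) : 𝕜) := by
    rw [stiffness, evalL_apply, inner_self_eq_norm_sq_to_K]
    push_cast
    ring
  rw [e]
  exact RCLike.ofReal_ne_zero.2 (by positivity)

/-- The coefficient of the hat function in `u''` for the solution of `Ã (u, v, p, q) = y`, read off
from the last component of the equation. -/
def jumpCoeff (𝕜 : Type*) [RCLike 𝕜] : P.L2 𝕜 × P.L2 𝕜 × 𝕜 × 𝕜 →L[𝕜] 𝕜 :=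
  (P.stiffness 𝕜)⁻¹ •
    ((P.m : 𝕜) • (ContinuousLinearMap.snd 𝕜 _ _ ∘L ContinuousLinearMap.snd 𝕜 _ _ ∘L
      ContinuousLinearMap.snd 𝕜 _ _) +
    (P.α₀ : 𝕜) • (P.evalL 𝕜 ∘L ContinuousLinearMap.fst 𝕜 _ _) +
    (P.ϰ : 𝕜) • (P.evalL 𝕜 ∘L P.dirichletL 𝕜 ∘L P.load 𝕜))

/-- The second derivative of the deflection solving `Ã (u, v, p, q) = y`. -/
def inverseProfile (𝕜 : Type*) [RCLike 𝕜] : P.L2 𝕜 × P.L2 𝕜 × 𝕜 × 𝕜 →L[𝕜] P.L2 𝕜 :=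
  P.dirichletL 𝕜 ∘L P.load 𝕜 + (P.jumpCoeff 𝕜).smulRight (P.hat 𝕜)

/-- The inverse of the generator in the coordinates `(u'', v, p, q)`. -/
def inverseCoords (𝕜 : Type*) [RCLike 𝕜] :
    P.L2 𝕜 × P.L2 𝕜 × 𝕜 × 𝕜 →L[𝕜] P.L2 𝕜 × P.L2 𝕜 × 𝕜 × 𝕜 :=
  (P.inverseProfile 𝕜).prod ((P.dirichletL 𝕜 ∘L ContinuousLinearMap.fst 𝕜 _ _).prod
    ((P.evalL 𝕜 ∘L P.inverseProfile 𝕜).prod (P.evalL 𝕜 ∘L ContinuousLinearMap.fst 𝕜 _ _)))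

/-- A bounded operator on all of `X` that inverts the generator on the compatible states. Its last
component is the value at `l₀` of the first component of `y`, so that its range lies in `D(Ã)` even
when `y` is not compatible. -/
def inverse (𝕜 : Type*) [RCLike 𝕜] : P.State 𝕜 →L[𝕜] P.State 𝕜 :=
  ((P.coords 𝕜).symm : _ →L[𝕜] P.State 𝕜) ∘L P.inverseCoords 𝕜 ∘L
    ((P.coords 𝕜 : P.State 𝕜 →L[𝕜] _))

theorem isCompactOperator_inverse : IsCompactOperator (P.inverse 𝕜) := by
  have h1 : IsCompactOperator (P.inverseProfile 𝕜) := by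
    refine (P.isCompactOperator_dirichletL.comp_clm (P.load 𝕜)).add ?_
    exact (isCompactOperator_functional (P.jumpCoeff 𝕜)).clm_comp
      (ContinuousLinearMap.toSpanSingleton 𝕜 (P.hat 𝕜))
  have h2 : IsCompactOperator (P.inverseCoords 𝕜) :=
    isCompactOperator_prod h1 (isCompactOperator_prod
      (P.isCompactOperator_dirichletL.comp_clm (ContinuousLinearMap.fst 𝕜 _ _))
      (isCompactOperator_prod (isCompactOperator_functional _) (isCompactOperator_functional _)))
  exact (h2.comp_clm ((P.coords 𝕜 : P.State 𝕜 →L[𝕜] _))).clm_comp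
    ((P.coords 𝕜).symm : _ →L[𝕜] P.State 𝕜)

theorem inverse_apply (y : P.State 𝕜) : P.inverse 𝕜 y =
    P.domainMk (P.load 𝕜 (P.coords 𝕜 y)) (P.jumpCoeff 𝕜 (P.coords 𝕜 y)) y.u := by
  refine State.ext rfl ?_ ?_ ?_
  · exact congrArg Subtype.val (P.dirichlet_secondDeriv y.u)
  · exact (P.evalL₀_dirichlet _).symm
  · exact P.evalL_secondDeriv y.u

theorem inverse_mem (y : P.State 𝕜) : P.inverse 𝕜 y ∈ (P.generator 𝕜).domain := by
  rw [inverse_apply]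
  exact P.domainMk_mem _ _ _

theorem generator_inverse {y : P.State 𝕜} (hy : y ∈ P.compatible 𝕜) :
    P.generator 𝕜 ⟨P.inverse 𝕜 y, P.inverse_mem y⟩ = y := by
  set g := P.load 𝕜 (P.coords 𝕜 y) with hg
  set β := P.jumpCoeff 𝕜 (P.coords 𝕜 y) with hβ
  have hρ : (P.ρ : 𝕜) ≠ 0 := RCLike.ofReal_ne_zero.2 P.ρ_pos.ne'
  have hm : (P.m : 𝕜) ≠ 0 := RCLike.ofReal_ne_zero.2 P.m_pos.ne'
  have hE : (P.E : 𝕜) ≠ 0 := RCLike.ofReal_ne_zero.2 P.E_pos.ne'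
  have hI : (P.I : 𝕜) ≠ 0 := RCLike.ofReal_ne_zero.2 P.I_pos.ne'
  have e0 : (⟨P.inverse 𝕜 y, P.inverse_mem y⟩ : (P.generator 𝕜).domain) =
      ⟨P.domainMk g β y.u, P.domainMk_mem g β y.u⟩ := Subtype.ext (P.inverse_apply y)
  have hyp : y.p = P.evalL₀ y.u := hy
  rw [e0]
  refine (P.generator_apply ⟨P.domainMk g β y.u, P.domainMk_mem g β y.u⟩ y.u.2).trans ?_
  rw [fourthDeriv_domainMk, shearJump_domainMk]
  refine State.ext rfl ?_ hyp.symm ?_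
  · have e1 : g = ((P.ρ / (P.E * P.I) : ℝ) : 𝕜) •
        (((1 / P.ρ : ℝ) : 𝕜) • (∑ j, P.distControl j (y.u : P.L2 𝕜) • P.ψL2 𝕜 j) - y.v) := by
      rw [hg, load, coords_apply]
      simp [distControl_eq]
    have e2 : (P.domainMk g β y.u).v = y.u := rfl
    have e3 : ((P.E * P.I / P.ρ : ℝ) : 𝕜) * ((P.ρ / (P.E * P.I) : ℝ) : 𝕜) = 1 := by
      push_cast; field_simp
    simp only [State.v_mk, e2]
    rw [neg_smul, e1, smul_smul, e3, one_smul]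
    abel
  · have e1 : P.stiffness 𝕜 * β = P.m * y.q + P.α₀ * P.evalL₀ y.u +
        P.ϰ * P.evalL 𝕜 (P.dirichlet 𝕜 g) := by
      have : P.stiffness 𝕜 * β = P.m * y.q + P.α₀ * P.evalL 𝕜 (P.secondDeriv y.u) +
          P.ϰ * P.evalL 𝕜 (P.dirichlet 𝕜 g) := mul_inv_cancel_left₀ P.stiffness_ne_zero _
      rw [this, evalL_secondDeriv]
    have e2 : (P.domainMk g β y.u).p =
        P.evalL 𝕜 (P.dirichlet 𝕜 g) + β * P.evalL 𝕜 (P.hat 𝕜) := by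
      rw [domainMk, State.p_mk, evalL₀_dirichlet, profile, map_add, map_smul, smul_eq_mul]
    have e3 : (P.domainMk g β y.u).q = P.evalL₀ y.u := rfl
    simp only [State.q_mk, lumpedControl, e2, e3]
    have e4 : ((P.E * P.I : ℝ) : 𝕜) * ((P.l : 𝕜) * β) - P.ϰ * (P.evalL 𝕜 (P.dirichlet 𝕜 g) +
        β * P.evalL 𝕜 (P.hat 𝕜)) + -(P.α₀ : 𝕜) * P.evalL₀ y.u = P.m * y.q := by
      rw [stiffness] at e1
      linear_combination e1
    rw [e4]
    push_cast
    field_simp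

end Inverse

/-! ### Maximality, compact resolvent and precompact trajectories -/

section Main

variable {𝕜 : Type*} [RCLike 𝕜] (P : BeamSystem)

theorem isDissipative_generator : IsDissipative (P.generator 𝕜) := P.re_inner_generator_nonpos

theorem domain_le_compatible : (P.generator 𝕜).domain ≤ P.compatible 𝕜 := fun _ h => h.2.2.2.2.2

theorem generator_mem_compatible (ξ : (P.generator 𝕜).domain) :
    P.generator 𝕜 ξ ∈ P.compatible 𝕜 := by
  obtain ⟨hv, hq⟩ := ξ.2.2.2.2.2.1
  exact hq

theorem exists_isResolventOn {μ : ℝ} (hμ : 0 < μ) :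
    ∃ J : P.State 𝕜 →L[𝕜] P.State 𝕜, IsCompactOperator J ∧
      IsResolventOn (P.generator 𝕜) (P.compatible 𝕜) μ J :=
  P.isDissipative_generator.exists_isResolventOn P.isCompactOperator_inverse P.inverse_mem
    P.domain_le_compatible (fun _ hy => P.generator_inverse hy) hμ

theorem injective_idSubSmul {lam : ℝ} (hlam : 0 < lam) :
    Function.Injective (P.idSubSmul 𝕜 lam).toFun := fun _ _ h =>
  P.isDissipative_generator.eq_of_sub_smul_eq hlam.le h

theorem range_idSubSmul {lam : ℝ} (hlam : 0 < lam) :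
    LinearMap.range (P.idSubSmul 𝕜 lam).toFun = P.compatible 𝕜 := by
  refine le_antisymm ?_ fun y hy => ?_
  · rintro _ ⟨ξ, rfl⟩
    exact (P.compatible 𝕜).sub_mem (P.domain_le_compatible ξ.2)
      ((P.compatible 𝕜).smul_mem _ (P.generator_mem_compatible ξ))
  · obtain ⟨J, -, hJ⟩ := P.exists_isResolventOn (𝕜 := 𝕜) hlam
    obtain ⟨h, e⟩ := hJ y hy
    exact ⟨⟨J y, h⟩, e⟩

theorem isCompactOperator_resolvent {lam : ℝ} (hlam : 0 < lam) : IsCompactOperator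
    (fun y : (P.resolvent 𝕜 lam).domain => (P.resolvent 𝕜 lam y : P.State 𝕜)) := by
  obtain ⟨J, hJc, hJ⟩ := P.exists_isResolventOn (𝕜 := 𝕜) hlam
  have hker : (P.idSubSmul 𝕜 lam).toFun.ker = ⊥ :=
    LinearMap.ker_eq_bot.2 (P.injective_idSubSmul hlam)
  have e : (fun y : (P.resolvent 𝕜 lam).domain => (P.resolvent 𝕜 lam y : P.State 𝕜)) =
      fun y : (P.resolvent 𝕜 lam).domain => J (y : P.State 𝕜) := by
    funext y
    have hy : (y : P.State 𝕜) ∈ P.compatible 𝕜 := by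
      rw [← P.range_idSubSmul hlam, ← LinearPMap.inverse_domain]; exact y.2
    obtain ⟨h, e⟩ := hJ y hy
    exact LinearPMap.inverse_apply_eq hker (x := ⟨J y, h⟩) e
  rw [e]
  exact hJc.comp_clm (P.resolvent 𝕜 lam).domain.subtypeL

end Main

end BeamSystem

end

end ShakerBeam

theorem theorem1 {𝕜 : Type*} [RCLike 𝕜] (P : ShakerBeam.BeamSystem) :
    (∀ lam : ℝ, 0 < lam →
      Function.Injective (P.idSubSmul 𝕜 lam).toFun ∧
      LinearMap.range (P.idSubSmul 𝕜 lam).toFun = P.compatible 𝕜 ∧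
      IsCompactOperator
        (fun y : (P.resolvent 𝕜 lam).domain => (P.resolvent 𝕜 lam y : P.State 𝕜))) ∧
    (∀ ξ : ℝ → P.State 𝕜, ShakerBeam.BeamSystem.IsTrajectory ξ →
      IsCompact (closure (ξ '' Set.Ici 0))) := by
  refine ⟨fun lam hlam => ⟨P.injective_idSubSmul hlam, P.range_idSubSmul hlam,
    P.isCompactOperator_resolvent hlam⟩, ?_⟩
  rintro ξ ⟨h1, η, -, h2, h3⟩
  exact (ShakerBeam.IsMildSolution.mk h1 h2 h3).isCompact_closure P.isDissipative_generator
    P.domain_le_compatible P.generator_mem_compatible P.isClosed_compatible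
    fun _ => P.exists_isResolventOn
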